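/- Let $(M,\langle\cdot,\cdot\rangle)$ be an $m$-dimensional Lorentzian manifold (signature $(-,+,\dots,+)$) with Levi-Civita connection $\nabla$, and let $\mathcal K_t,\mathcal K_\varphi$ be two commuting Killing vector fields on $M$ such that $\mathcal G=\det(\mathcal G_{\alpha\beta})<0$, where $\mathcal G_{\alpha\beta}=\langle\mathcal K_\alpha,\mathcal K_\beta\rangle$, $\alpha,\beta\in\{t,\varphi\}$. Fix a constant $\rho\in\mathbb R$ and put $\rho^\alpha=(\rho,1)$, $\hat\rho=\rho^\alpha\mathcal K_\alpha$ and $\tau^\alpha=\mathcal G^{\alpha\lambda}\epsilon_{\lambda\beta}\rho^\beta$, where $\epsilon_{\alpha\beta}$ is the two-dimensional Levi-Civita tensor ($\epsilon_{t\varphi}=-\epsilon_{\varphi t}=\sqrt{|\mathcal G|}$). Let $S\to M$ be an isometrically embedded $n$-dimensional Lorentzian submanifold which is invariant, i.e. $\mathcal K_\alpha$ and $[\mathcal K_\alpha,\mathcal K_\beta]$ are tangent to $S$. Let ${\rm II}(X,Y)=(\nabla_YX)^\perp$, $X,Y\in TS$, be its second fundamental form, and assume that $S$ is totally $\hat\rho^\perp$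 umbilic: there is a normal vector field ${\rm H}$ along $S$ with ${\rm II}(X,Y)={\rm H}\langle X,Y\rangle$ for all $X,Y\in TS$ orthogonal to $\hat\rho$. Let $p\in S$, and let $\xi_1,\dots,\xi_{m-n}\in T_pS^\perp$ be pairwise orthogonal unit normals, $\epsilon_A=\langle\xi_A,\xi_A\rangle=\pm1$. For a function $\phi$ on $M$ put $\nabla^\perp\phi=\sum_{A=1}^{m-n}\epsilon_A(\nabla_{\xi_A}\phi)\,\xi_A$. Then at $p$ the following hold. 1. For every basis $\{\mathcal K_\alpha,e_a\}$ ($a=1,\dots,n-2$) of $T_pS$ with all $e_a$ orthogonal to $\mathcal K_t,\mathcal K_\varphi$, the second fundamental form has in this basis the block form $${\rm II}=\begin{pmatrix}-\frac12\nabla^\perp\mathcal G_{\alpha\beta} & -\sum_{A}\epsilon_A\langle\nabla_{\xi_A}\mathcal K_\alpha,e_b\rangle\,\xi_A\\ -\sum_{A}\epsilon_A\langle\nabla_{\xi_A}\mathcal K_\beta,e_a\rangle\,\xi_A & {\rm H}\langle e_a,e_b\rangle\end{pmatrix},$$ and $\tau^\alpha\,{\rm II}(\mathcal K_\alpha,e_a)=0$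 for all $a$. 2. The master equation $\rho^\alpha\mathcal M_{\alpha\beta}\rho^\beta=0$ holds, where $\mathcal M_{\alpha\beta}=\frac12\nabla^\perp(\mathcal G^{-1}\mathcal G_{\alpha\beta})-\mathcal G^{-1}\mathcal G_{\alpha\beta}\,{\rm H}$. 3. If $\langle\hat\rho,\hat\rho\rangle\neq0$ at $p$, then the master equation, regarded as an equation for an unknown vector ${\rm H}\in T_pM$, is equivalent to ${\rm H}=\frac12\nabla^\perp\ln\left|\mathcal G^{-1}\langle\hat\rho,\hat\rho\rangle\right|$; in particular this formula holds for the umbilic factor ${\rm H}$. -/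

import Mathlib

open Bundle Manifold ContDiff VectorField

set_option linter.unusedSectionVars false

noncomputable section

/-- A smooth Lorentzian metric (signature `(-, +, ..., +)`) on an `m`-dimensional manifold:
at each point there is a timelike vector on whose orthogonal complement the scalar product is
positive definite. -/
structure LorentzianMetric (m : ℕ) (M : Type*) [TopologicalSpace M]
    [ChartedSpace (EuclideanSpace ℝ (Fin m)) M] [IsManifold (𝓡 m) ∞ M] where
  /-- The scalar product on the tangent space at `x`. -/
  inner (x : M) : TangentSpace (𝓡 m) x →L[ℝ] TangentSpace (𝓡 m) x →L[ℝ] ℝ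
  symm (x : M) (v w : TangentSpace (𝓡 m) x) : inner x v w = inner x w v
  signature (x : M) : ∃ v : TangentSpace (𝓡 m) x, inner x v v < 0 ∧
    ∀ w : TangentSpace (𝓡 m) x, inner x v w = 0 → w ≠ 0 → 0 < inner x w w
  contMDiff : ContMDiff (𝓡 m)
    ((𝓡 m).prod 𝓘(ℝ, EuclideanSpace ℝ (Fin m) →L[ℝ] EuclideanSpace ℝ (Fin m) →L[ℝ] ℝ)) ∞
    (fun x ↦ TotalSpace.mk' (EuclideanSpace ℝ (Fin m) →L[ℝ] EuclideanSpace ℝ (Fin m) →L[ℝ] ℝ)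
      x (inner x))

namespace LorentzianMetric

section Connection

variable {m n : ℕ} {M : Type*} [TopologicalSpace M]
    [ChartedSpace (EuclideanSpace ℝ (Fin m)) M] [IsManifold (𝓡 m) ∞ M]
    {S : Type*} [TopologicalSpace S]
    [ChartedSpace (EuclideanSpace ℝ (Fin n)) S] [IsManifold (𝓡 n) ∞ S]

/-- The metric coefficients `g_ij` at `x` in the chart around `x₀`, as a bilinear form on `ℝᵐ`. -/
def coeff (g : LorentzianMetric m M) (x₀ x : M) :
    EuclideanSpace ℝ (Fin m) →L[ℝ] EuclideanSpace ℝ (Fin m) →L[ℝ] ℝ :=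
  letI e := (trivializationAt (EuclideanSpace ℝ (Fin m)) (TangentSpace (𝓡 m)) x₀).symmL ℝ x
  (e.precomp ℝ) ∘L (g.inner x ∘L e)

/-- The derivative at `x` of the metric coefficients in the chart around `x`:
`∂g(u)(v, w)` is `∂_u g(v, w)`. -/
def coeffDeriv (g : LorentzianMetric m M) (x : M) :
    EuclideanSpace ℝ (Fin m) →L[ℝ]
      EuclideanSpace ℝ (Fin m) →L[ℝ] EuclideanSpace ℝ (Fin m) →L[ℝ] ℝ :=
  mvfderiv (𝓡 m) (g.coeff x) x ∘L
    (trivializationAt (EuclideanSpace ℝ (Fin m)) (TangentSpace (𝓡 m)) x).symmL ℝ x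

/-- The Christoffel term `u ↦ Γ(u, v)` at `x`, in the chart around `x`:
`⟨Γ(u, v), w⟩ = ½ (∂_u g(v, w) + ∂_v g(u, w) - ∂_w g(v, u))`. -/
def christoffel (g : LorentzianMetric m M) (x : M) (v : TangentSpace (𝓡 m) x) :
    TangentSpace (𝓡 m) x →L[ℝ] TangentSpace (𝓡 m) x :=
  letI L := (trivializationAt (EuclideanSpace ℝ (Fin m))
    (TangentSpace (𝓡 m)) x).continuousLinearMapAt ℝ x
  letI D := g.coeffDeriv x
  (2⁻¹ : ℝ) • (g.inner x).inverse ∘L L.precomp ℝ ∘L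
    (D.flip (L v) + D (L v) - (D.flip (L v)).flip) ∘L L

/-- The covariant derivative `v ↦ ∇_v Z` at `p`, for the Levi-Civita connection of `g`, of a vector
field `Z` along a map `f : S → M`. In the chart around `f p` it is
`∂_v Z + Γ(df v, Z)`. -/
def covDerivAlong (g : LorentzianMetric m M) (f : S → M)
    (Z : Π q : S, TangentSpace (𝓡 m) (f q)) (p : S) :
    TangentSpace (𝓡 n) p →L[ℝ] TangentSpace (𝓡 m) (f p) :=
  letI t := trivializationAt (EuclideanSpace ℝ (Fin m)) (TangentSpace (𝓡 m)) (f p)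
  t.symmL ℝ (f p) ∘L mvfderiv (𝓡 n) (fun q ↦ (t ⟨f q, Z q⟩).2) p +
    g.christoffel (f p) (Z p) ∘L mfderiv (𝓡 n) (𝓡 m) f p

/-- The Levi-Civita connection of `g`: the linear map `v ↦ ∇_v X` at `x`. In the chart around `x`
it is `∂_v X + Γ(v, X)`. -/
def leviCivita (g : LorentzianMetric m M) (X : Π x : M, TangentSpace (𝓡 m) x) (x : M) :
    TangentSpace (𝓡 m) x →L[ℝ] TangentSpace (𝓡 m) x :=
  letI t := trivializationAt (EuclideanSpace ℝ (Fin m)) (TangentSpace (𝓡 m)) x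
  t.symmL ℝ x ∘L mvfderiv (𝓡 m) (fun y ↦ (t ⟨y, X y⟩).2) x + g.christoffel x (X x)

lemma isInvertible_inner (g : LorentzianMetric m M) (x : M) : (g.inner x).IsInvertible := by
  have hinj : Function.Injective (g.inner x) := by
    rw [injective_iff_map_eq_zero]
    intro u hu
    obtain ⟨v, hv, hw⟩ := g.signature x
    by_contra hne
    have := hw u (by rw [g.symm, hu]; rfl) hne
    rw [hu] at this
    simp at this
  let A : EuclideanSpace ℝ (Fin m) →L[ℝ] EuclideanSpace ℝ (Fin m) →L[ℝ] ℝ := g.inner x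
  let L : EuclideanSpace ℝ (Fin m) →ₗ[ℝ] EuclideanSpace ℝ (Fin m) →L[ℝ] ℝ := A
  have hL : Function.Injective L := hinj
  have hd : Module.finrank ℝ (EuclideanSpace ℝ (Fin m)) =
      Module.finrank ℝ (EuclideanSpace ℝ (Fin m) →L[ℝ] ℝ) := by
    rw [← LinearEquiv.finrank_eq (LinearMap.toContinuousLinearMap (𝕜 := ℝ)
      (E := EuclideanSpace ℝ (Fin m)) (F' := ℝ))]
    exact (Subspace.dual_finrank_eq).symm
  let e := LinearEquiv.ofInjectiveOfFinrankEq L hL hd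
  refine ⟨e.toContinuousLinearEquiv, ?_⟩
  ext u v
  rfl

lemma inner_christoffel (g : LorentzianMetric m M) (x : M) (v u w : TangentSpace (𝓡 m) x) :
    letI L := (trivializationAt (EuclideanSpace ℝ (Fin m))
      (TangentSpace (𝓡 m)) x).continuousLinearMapAt ℝ x
    letI D := g.coeffDeriv x
    g.inner x (g.christoffel x v u) w =
      2⁻¹ * (D (L u) (L v) (L w) + D (L v) (L u) (L w) - D (L w) (L v) (L u)) := by
  have key : ∀ y, g.inner x ((g.inner x).inverse y) = y := fun y ↦
    ((g.isInvertible_inner x).inverse_apply_eq.1 rfl).symm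
  rw [christoffel, _root_.smul_apply, map_smul, ContinuousLinearMap.comp_apply, key]
  rfl

lemma coeff_symm (g : LorentzianMetric m M) (x₀ x : M) (u v) :
    g.coeff x₀ x u v = g.coeff x₀ x v u := g.symm x _ _

lemma coeff_apply (g : LorentzianMetric m M) {x₀ x : M}
    (hx : x ∈ (trivializationAt (EuclideanSpace ℝ (Fin m)) (TangentSpace (𝓡 m)) x₀).baseSet)
    (u v : TangentSpace (𝓡 m) x) :
    g.coeff x₀ x (trivializationAt (EuclideanSpace ℝ (Fin m)) (TangentSpace (𝓡 m)) x₀ ⟨x, u⟩).2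
      (trivializationAt (EuclideanSpace ℝ (Fin m)) (TangentSpace (𝓡 m)) x₀ ⟨x, v⟩).2 =
    g.inner x u v := by
  let t := trivializationAt (EuclideanSpace ℝ (Fin m)) (TangentSpace (𝓡 m)) x₀
  have h : ∀ u : TangentSpace (𝓡 m) x, t.symmL ℝ x (t ⟨x, u⟩).2 = u := fun u ↦ by
    have := t.symmL_continuousLinearMapAt (R := ℝ) hx u
    rwa [t.continuousLinearMapAt_apply (R := ℝ), t.coe_linearMapAt_of_mem (R := ℝ) hx] at this
  change g.inner x (t.symmL ℝ x (t ⟨x, u⟩).2) (t.symmL ℝ x (t ⟨x, v⟩).2) = _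
  rw [h, h]

lemma mdifferentiableAt_coeff (g : LorentzianMetric m M) (x₀ : M) :
    MDifferentiableAt (𝓡 m)
      𝓘(ℝ, EuclideanSpace ℝ (Fin m) →L[ℝ] EuclideanSpace ℝ (Fin m) →L[ℝ] ℝ)
      (g.coeff x₀) x₀ := by
  have h := (contMDiffAt_section _).1 (g.contMDiff x₀)
  refine (h.mdifferentiableAt (by simp)).congr_of_eventuallyEq ?_
  let t := trivializationAt (EuclideanSpace ℝ (Fin m)) (TangentSpace (𝓡 m)) x₀
  filter_upwards [t.open_baseSet.mem_nhds (FiberBundle.mem_baseSet_trivializationAt' x₀)] with x hx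
  ext u v
  simp [hom_trivializationAt_apply, ContinuousLinearMap.inCoordinates, coeff]
  have hb : x ∈ (trivializationAt (EuclideanSpace ℝ (Fin m) →L[ℝ] ℝ)
      (fun x ↦ TangentSpace (𝓡 m) x →L[ℝ] ℝ) x₀).baseSet := by
    rw [hom_trivializationAt_baseSet]
    exact ⟨hx, by simp⟩
  rw [Trivialization.coe_linearMapAt_of_mem _ hb]
  simp [hom_trivializationAt_apply, ContinuousLinearMap.inCoordinates]

lemma mvfderiv_clm_apply {F G : Type*} [NormedAddCommGroup F] [NormedSpace ℝ F]
    [NormedAddCommGroup G] [NormedSpace ℝ G] {c : S → F →L[ℝ] G} {z : S → F} {p : S}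
    (hc : MDifferentiableAt (𝓡 n) 𝓘(ℝ, F →L[ℝ] G) c p)
    (hz : MDifferentiableAt (𝓡 n) 𝓘(ℝ, F) z p) (v : TangentSpace (𝓡 n) p) :
    mvfderiv (𝓡 n) (fun q ↦ c q (z q)) p v =
      mvfderiv (𝓡 n) c p v (z p) + c p (mvfderiv (𝓡 n) z p v) := by
  have h1 := hc.hasMFDerivAt.2
  have h2 := hz.hasMFDerivAt.2
  have h := h1.clm_apply h2
  have h3 : HasMFDerivAt (𝓡 n) 𝓘(ℝ, G) (fun q ↦ c q (z q)) p _ :=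
    ⟨(hc.clm_apply hz).continuousAt, h⟩
  rw [mvfderiv, h3.mfderiv]
  simp [mvfderiv, add_comm]
  rfl

lemma mvfderiv_congr {F : Type*} [NormedAddCommGroup F] [NormedSpace ℝ F] {z w : S → F} {p : S}
    (h : z =ᶠ[nhds p] w) (v : TangentSpace (𝓡 n) p) :
    mvfderiv (𝓡 n) z p v = mvfderiv (𝓡 n) w p v := by
  have h1 := h.mfderiv_eq (I := 𝓡 n) (I' := 𝓘(ℝ, F))
  have h2 := h.eq_of_nhds
  simp only [mvfderiv]
  exact congr($h1 v)

lemma coeffDeriv_symm (g : LorentzianMetric m M) (x : M) (u v w : EuclideanSpace ℝ (Fin m)) :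
    g.coeffDeriv x u v w = g.coeffDeriv x u w v := by
  have hc := g.mdifferentiableAt_coeff x
  let u' := (trivializationAt (EuclideanSpace ℝ (Fin m)) (TangentSpace (𝓡 m)) x).symmL ℝ x u
  have key : ∀ a b : EuclideanSpace ℝ (Fin m),
      mvfderiv (𝓡 m) (fun y ↦ g.coeff x y a b) x u' = g.coeffDeriv x u a b := fun a b ↦ by
    have ha := hc.clm_apply (mdifferentiableAt_const (c := a))
    rw [mvfderiv_clm_apply ha (mdifferentiableAt_const (c := b)),
      mvfderiv_clm_apply hc (mdifferentiableAt_const (c := a)), mvfderiv_const, mvfderiv_const]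
    simp [coeffDeriv, u']
  rw [← key, ← key]
  congr! 3 with y
  exact g.coeff_symm x y v w

/-- Compatibility with the metric along a map. -/
lemma mvfderiv_inner_along (g : LorentzianMetric m M) {f : S → M} {p : S}
    (hf : MDifferentiableAt (𝓡 n) (𝓡 m) f p)
    {Z W : Π q : S, TangentSpace (𝓡 m) (f q)}
    (hZ : MDifferentiableAt (𝓡 n) 𝓘(ℝ, EuclideanSpace ℝ (Fin m))
      (fun q ↦ (trivializationAt (EuclideanSpace ℝ (Fin m)) (TangentSpace (𝓡 m)) (f p)
        ⟨f q, Z q⟩).2) p)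
    (hW : MDifferentiableAt (𝓡 n) 𝓘(ℝ, EuclideanSpace ℝ (Fin m))
      (fun q ↦ (trivializationAt (EuclideanSpace ℝ (Fin m)) (TangentSpace (𝓡 m)) (f p)
        ⟨f q, W q⟩).2) p) (v : TangentSpace (𝓡 n) p) :
    mvfderiv (𝓡 n) (fun q ↦ g.inner (f q) (Z q) (W q)) p v =
      g.inner (f p) (g.covDerivAlong f Z p v) (W p) +
      g.inner (f p) (Z p) (g.covDerivAlong f W p v) := by
  let t := trivializationAt (EuclideanSpace ℝ (Fin m)) (TangentSpace (𝓡 m)) (f p)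
  let z := fun q ↦ (t ⟨f q, Z q⟩).2
  let w := fun q ↦ (t ⟨f q, W q⟩).2
  have hp : f p ∈ t.baseSet := FiberBundle.mem_baseSet_trivializationAt' (f p)
  have hev : (fun q ↦ g.inner (f q) (Z q) (W q)) =ᶠ[nhds p]
      fun q ↦ g.coeff (f p) (f q) (z q) (w q) := by
    filter_upwards [hf.continuousAt.preimage_mem_nhds (t.open_baseSet.mem_nhds hp)] with q hq
    exact (g.coeff_apply hq _ _).symm
  have hc := (g.mdifferentiableAt_coeff (f p)).comp p hf
  have hcz := hc.clm_apply hZ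
  have hm : mvfderiv (𝓡 n) (fun q ↦ g.inner (f q) (Z q) (W q)) p v =
      mvfderiv (𝓡 n) (fun q ↦ g.coeff (f p) (f q) (z q) (w q)) p v := mvfderiv_congr hev v
  have hL : ∀ u, t.continuousLinearMapAt ℝ (f p) (t.symmL ℝ (f p) u) = u :=
    t.continuousLinearMapAt_symmL (R := ℝ) hp
  have hL' : ∀ u, t.symmL ℝ (f p) (t.continuousLinearMapAt ℝ (f p) u) = u :=
    t.symmL_continuousLinearMapAt (R := ℝ) hp
  have hzp : t.continuousLinearMapAt ℝ (f p) (Z p) = z p := by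
    rw [t.continuousLinearMapAt_apply (R := ℝ), t.coe_linearMapAt_of_mem (R := ℝ) hp]
  have hwp : t.continuousLinearMapAt ℝ (f p) (W p) = w p := by
    rw [t.continuousLinearMapAt_apply (R := ℝ), t.coe_linearMapAt_of_mem (R := ℝ) hp]
  have hD : mvfderiv (𝓡 n) (g.coeff (f p) ∘ f) p v =
      g.coeffDeriv (f p) (t.continuousLinearMapAt ℝ (f p) (mfderiv (𝓡 n) (𝓡 m) f p v)) := by
    refine (mfderiv_comp_apply p (g.mdifferentiableAt_coeff (f p)) hf v).trans ?_
    change _ = mvfderiv (𝓡 m) (g.coeff (f p)) (f p) (t.symmL ℝ (f p) _)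
    rw [hL']
    rfl
  have hI : ∀ a b, g.inner (f p) (t.symmL ℝ (f p) a) (t.symmL ℝ (f p) b) =
    g.coeff (f p) (f p) a b := fun a b ↦ rfl
  have hsz : t.symmL ℝ (f p) (z p) = Z p := by rw [← hzp, hL']
  have hsw : t.symmL ℝ (f p) (w p) = W p := by rw [← hwp, hL']
  have e1 := mvfderiv_clm_apply hcz hW v
  rw [mvfderiv_clm_apply hc hZ, hD] at e1
  have e2 : g.inner (f p) (g.covDerivAlong f Z p v) (W p) =
      g.coeff (f p) (f p) (mvfderiv (𝓡 n) z p v) (w p) +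
      g.inner (f p) (g.christoffel (f p) (Z p) (mfderiv (𝓡 n) (𝓡 m) f p v)) (W p) := by
    rw [← hI, hsw, covDerivAlong, add_apply, map_add, add_apply]
    rfl
  have e3 : g.inner (f p) (Z p) (g.covDerivAlong f W p v) =
      g.coeff (f p) (f p) (z p) (mvfderiv (𝓡 n) w p v) +
      g.inner (f p) (g.christoffel (f p) (W p) (mfderiv (𝓡 n) (𝓡 m) f p v)) (Z p) := by
    rw [← hI, hsz, covDerivAlong, add_apply, map_add, g.symm _ (g.christoffel _ _ _)]
    rfl
  rw [inner_christoffel] at e2 e3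
  rw [hm, e2, e3]
  refine e1.trans ?_
  change _ + g.coeff (f p) (f p) (mvfderiv (𝓡 n) z p v) (w p) +
    g.coeff (f p) (f p) (z p) (mvfderiv (𝓡 n) w p v) = _
  rw [hzp, hwp, coeffDeriv_symm g _ (w p) (z p), coeffDeriv_symm g _ (z p) _ (w p),
    coeffDeriv_symm g _ _ (w p) (z p)]
  change g.coeffDeriv (f p) _ (z p) (w p) + _ + _ = _
  ring



/-- Vectors are determined by their scalar products. -/
lemma ext_inner (g : LorentzianMetric m M) {x : M} {u v : TangentSpace (𝓡 m) x}
    (h : ∀ w, g.inner x u w = g.inner x v w) : u = v := by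
  obtain ⟨e, he⟩ := g.isInvertible_inner x
  apply e.injective
  rw [← ContinuousLinearEquiv.coe_coe, he]
  exact ContinuousLinearMap.ext h

lemma christoffel_symm (g : LorentzianMetric m M) (x : M) (u v : TangentSpace (𝓡 m) x) :
    g.christoffel x u v = g.christoffel x v u := by
  refine g.ext_inner fun z ↦ ?_
  rw [inner_christoffel, inner_christoffel]
  rw [coeffDeriv_symm g x (Trivialization.continuousLinearMapAt ℝ _ x z)]
  ring

lemma christoffel_add (g : LorentzianMetric m M) (x : M) (v w : TangentSpace (𝓡 m) x) :
    g.christoffel x (v + w) = g.christoffel x v + g.christoffel x w := by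
  refine ContinuousLinearMap.ext fun u ↦ ?_
  rw [add_apply, christoffel_symm, map_add, christoffel_symm, g.christoffel_symm x u]

lemma christoffel_smul (g : LorentzianMetric m M) (x : M) (c : ℝ) (v : TangentSpace (𝓡 m) x) :
    g.christoffel x (c • v) = c • g.christoffel x v := by
  refine ContinuousLinearMap.ext fun u ↦ ?_
  rw [_root_.smul_apply, christoffel_symm, map_smul, christoffel_symm]

lemma isCovariantDerivativeOn_leviCivita (g : LorentzianMetric m M) :
    IsCovariantDerivativeOn (EuclideanSpace ℝ (Fin m)) g.leviCivita where
  add {σ σ' x} hσ hσ' _ := by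
    let t := trivializationAt (EuclideanSpace ℝ (Fin m)) (TangentSpace (𝓡 m)) x
    have hx : x ∈ t.baseSet := FiberBundle.mem_baseSet_trivializationAt' x
    rw [mdifferentiableAt_section] at hσ hσ'
    have hev : (fun y ↦ (t ⟨y, (σ + σ') y⟩).2) =ᶠ[nhds x]
        (fun y ↦ (t ⟨y, σ y⟩).2) + fun y ↦ (t ⟨y, σ' y⟩).2 := by
      filter_upwards [t.open_baseSet.mem_nhds hx] with y hy
      exact (t.linear ℝ hy).map_add _ _
    refine ContinuousLinearMap.ext fun v ↦ ?_
    change t.symmL ℝ x (mvfderiv (𝓡 m) (fun y ↦ (t ⟨y, (σ + σ') y⟩).2) x v) +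
      g.christoffel x (σ x + σ' x) v = _
    rw [mvfderiv_congr hev, mvfderiv_add hσ hσ', christoffel_add, add_apply, map_add, add_apply]
    exact add_add_add_comm _ _ _ _
  leibniz {σ f x} hσ hf _ := by
    let t := trivializationAt (EuclideanSpace ℝ (Fin m)) (TangentSpace (𝓡 m)) x
    have hx : x ∈ t.baseSet := FiberBundle.mem_baseSet_trivializationAt' x
    rw [mdifferentiableAt_section] at hσ
    have hev : (fun y ↦ (t ⟨y, (f • σ) y⟩).2) =ᶠ[nhds x]
        f • (fun y ↦ (t ⟨y, σ y⟩).2) := by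
      filter_upwards [t.open_baseSet.mem_nhds hx] with y hy
      exact (t.linear ℝ hy).map_smul _ _
    have hsx : t.symmL ℝ x (t ⟨x, σ x⟩).2 = σ x := by
      have := t.symmL_continuousLinearMapAt (R := ℝ) hx (σ x)
      rwa [t.continuousLinearMapAt_apply (R := ℝ), t.coe_linearMapAt_of_mem (R := ℝ) hx] at this
    refine ContinuousLinearMap.ext fun v ↦ ?_
    change t.symmL ℝ x (mvfderiv (𝓡 m) (fun y ↦ (t ⟨y, (f • σ) y⟩).2) x v) +
      g.christoffel x (f x • σ x) v = _
    rw [mvfderiv_congr hev, mvfderiv_smul hf hσ, christoffel_smul, add_apply, map_add,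
      _root_.smul_apply, _root_.smul_apply, map_smul, ContinuousLinearMap.smulRight_apply, map_smul, hsx]
    rw [add_apply, _root_.smul_apply, leviCivita, add_apply, smul_add, add_right_comm]
    rfl

lemma leviCivita_extend (g : LorentzianMetric m M) (x : M) (u v : TangentSpace (𝓡 m) x) :
    g.leviCivita (FiberBundle.extend (EuclideanSpace ℝ (Fin m)) v) x u = g.christoffel x v u := by
  let t := trivializationAt (EuclideanSpace ℝ (Fin m)) (TangentSpace (𝓡 m)) x
  have hx : x ∈ t.baseSet := FiberBundle.mem_baseSet_trivializationAt' x
  have hev : (fun y ↦ (t ⟨y, FiberBundle.extend (EuclideanSpace ℝ (Fin m)) v y⟩).2) =ᶠ[nhds x]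
      fun _ ↦ (t ⟨x, v⟩).2 := by
    filter_upwards [t.open_baseSet.mem_nhds hx] with y hy
    have := t.apply_mk_symm hy (t ⟨x, v⟩).2
    exact congr($(this).2)
  rw [leviCivita, add_apply, ContinuousLinearMap.comp_apply, mvfderiv_congr hev, mvfderiv_const]
  simp

lemma mlieBracket_extend (x : M) (u v : TangentSpace (𝓡 m) x) :
    mlieBracket (𝓡 m) (FiberBundle.extend (EuclideanSpace ℝ (Fin m)) u)
      (FiberBundle.extend (EuclideanSpace ℝ (Fin m)) v) x = 0 := by
  let t := trivializationAt (EuclideanSpace ℝ (Fin m)) (TangentSpace (𝓡 m)) x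
  have hev : ∀ w : TangentSpace (𝓡 m) x,
      mpullbackWithin 𝓘(ℝ, EuclideanSpace ℝ (Fin m)) (𝓡 m) (extChartAt (𝓡 m) x).symm
        (FiberBundle.extend (EuclideanSpace ℝ (Fin m)) w) (Set.range (𝓡 m))
      =ᶠ[nhdsWithin (extChartAt (𝓡 m) x x) (Set.range (𝓡 m))] fun _ ↦ (t ⟨x, w⟩).2 := by
    intro w
    filter_upwards [extChartAt_target_mem_nhdsWithin (I := 𝓡 m) x] with y hy
    have hy' : (extChartAt (𝓡 m) x).symm y ∈ (chartAt (EuclideanSpace ℝ (Fin m)) x).source := by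
      rw [← extChartAt_source (𝓡 m)]
      exact (extChartAt (𝓡 m) x).map_target hy
    refine (isInvertible_mfderivWithin_extChartAt_symm hy).inverse_apply_eq.2 ?_
    have := TangentBundle.symmL_trivializationAt (I := 𝓡 m) (𝕜 := ℝ) hy'
    rw [(extChartAt (𝓡 m) x).right_inv hy] at this
    rw [← this]
    exact (Trivialization.symmL_apply (R := ℝ) _ hy' _).symm
  rw [mlieBracket, mlieBracketWithin_apply]
  have h0 : lieBracketWithin ℝ
      (mpullbackWithin 𝓘(ℝ, EuclideanSpace ℝ (Fin m)) (𝓡 m) (extChartAt (𝓡 m) x).symm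
        (FiberBundle.extend (EuclideanSpace ℝ (Fin m)) u) (Set.range (𝓡 m)))
      (mpullbackWithin 𝓘(ℝ, EuclideanSpace ℝ (Fin m)) (𝓡 m) (extChartAt (𝓡 m) x).symm
        (FiberBundle.extend (EuclideanSpace ℝ (Fin m)) v) (Set.range (𝓡 m)))
      ((extChartAt (𝓡 m) x).symm ⁻¹' Set.univ ∩ Set.range (𝓡 m)) (extChartAt (𝓡 m) x x) = 0 := by
    refine (Filter.EventuallyEq.lieBracketWithin_vectorField_eq_of_mem
      (V := fun _ ↦ (t ⟨x, u⟩).2) (W := fun _ ↦ (t ⟨x, v⟩).2) ?_ ?_ ?_).trans ?_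
    · simpa using hev u
    · simpa using hev v
    · simp
    · simp [lieBracketWithin]
  exact (congrArg _ h0).trans (map_zero _)

/-- The connection is torsion-free. -/
lemma leviCivita_torsion (g : LorentzianMetric m M) {X Y : Π x : M, TangentSpace (𝓡 m) x} {x : M}
    (hX : MDifferentiableAt (𝓡 m) (𝓡 m).tangent
      (fun y ↦ (⟨y, X y⟩ : TangentBundle (𝓡 m) M)) x)
    (hY : MDifferentiableAt (𝓡 m) (𝓡 m).tangent
      (fun y ↦ (⟨y, Y y⟩ : TangentBundle (𝓡 m) M)) x) :
    g.leviCivita Y x (X x) - g.leviCivita X x (Y x) = mlieBracket (𝓡 m) X Y x := by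
  have h := (g.isCovariantDerivativeOn_leviCivita).torsion_apply hX hY
  rw [IsCovariantDerivativeOn.torsion_apply_eq_extend, leviCivita_extend, leviCivita_extend,
    mlieBracket_extend, christoffel_symm, sub_self, sub_self] at h
  exact (sub_eq_zero.1 h.symm)

/-- The covariant derivative along `f` of the restriction of a vector field is the covariant
derivative of the vector field. -/
lemma covDerivAlong_comp (g : LorentzianMetric m M) {f : S → M} {p : S}
    (hf : MDifferentiableAt (𝓡 n) (𝓡 m) f p) {X : Π x : M, TangentSpace (𝓡 m) x}
    (hX : MDifferentiableAt (𝓡 m) (𝓡 m).tangent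
      (fun y ↦ (⟨y, X y⟩ : TangentBundle (𝓡 m) M)) (f p)) (v : TangentSpace (𝓡 n) p) :
    g.covDerivAlong f (fun q ↦ X (f q)) p v =
      g.leviCivita X (f p) (mfderiv (𝓡 n) (𝓡 m) f p v) := by
  rw [mdifferentiableAt_section] at hX
  let t := trivializationAt (EuclideanSpace ℝ (Fin m)) (TangentSpace (𝓡 m)) (f p)
  rw [covDerivAlong, leviCivita, add_apply, add_apply]
  congr 1
  exact congrArg (t.symmL ℝ (f p)) (mfderiv_comp_apply p hX hf v)

/-- The connection is compatible with the metric. -/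
lemma leviCivita_inner (g : LorentzianMetric m M) {X Y : Π x : M, TangentSpace (𝓡 m) x} {x : M}
    (hX : MDifferentiableAt (𝓡 m) (𝓡 m).tangent
      (fun y ↦ (⟨y, X y⟩ : TangentBundle (𝓡 m) M)) x)
    (hY : MDifferentiableAt (𝓡 m) (𝓡 m).tangent
      (fun y ↦ (⟨y, Y y⟩ : TangentBundle (𝓡 m) M)) x) (v : TangentSpace (𝓡 m) x) :
    mvfderiv (𝓡 m) (fun y ↦ g.inner y (X y) (Y y)) x v =
      g.inner x (g.leviCivita X x v) (Y x) + g.inner x (X x) (g.leviCivita Y x v) := by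
  have h := g.mvfderiv_inner_along (f := id) (p := x) mdifferentiableAt_id
    ((mdifferentiableAt_section ..).1 hX) ((mdifferentiableAt_section ..).1 hY) v
  have e := fun (Z) (hZ) ↦ g.covDerivAlong_comp (f := id) (p := x) mdifferentiableAt_id (X := Z) hZ v
  rw [mfderiv_id] at e
  exact h.trans (congrArg₂ (· + ·) (congrArg (fun z ↦ g.inner x z (Y x)) (e X hX))
    (congrArg (fun z ↦ g.inner x (X x) z) (e Y hY)))

end Connection

section Submanifold

variable {m n : ℕ} {M : Type*} [TopologicalSpace M]
    [ChartedSpace (EuclideanSpace ℝ (Fin m)) M] [IsManifold (𝓡 m) ∞ M]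
    {S : Type*} [TopologicalSpace S]
    [ChartedSpace (EuclideanSpace ℝ (Fin n)) S] [IsManifold (𝓡 n) ∞ S]

/-- `f : S → M` is an isometric embedding of Lorentzian manifolds. -/
structure IsIsometricEmbedding (g : LorentzianMetric m M) (gS : LorentzianMetric n S)
    (f : S → M) : Prop where
  isSmoothEmbedding : IsSmoothEmbedding (𝓡 n) (𝓡 m) ∞ f
  inner_eq (p : S) (x y : TangentSpace (𝓡 n) p) :
    gS.inner p x y = g.inner (f p) (mfderiv (𝓡 n) (𝓡 m) f p x) (mfderiv (𝓡 n) (𝓡 m) f p y)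

/-- The normal space `(T_p S)^⊥ ⊂ T_{f p} M`. -/
def normalSpace (g : LorentzianMetric m M) (n : ℕ) {S : Type*} [TopologicalSpace S]
    [ChartedSpace (EuclideanSpace ℝ (Fin n)) S] (f : S → M) (p : S) :
    Submodule ℝ (TangentSpace (𝓡 m) (f p)) where
  carrier := {w | ∀ x : TangentSpace (𝓡 n) p, g.inner (f p) w (mfderiv (𝓡 n) (𝓡 m) f p x) = 0}
  add_mem' {v w} hv hw x := by rw [map_add, add_apply, hv x, hw x, add_zero]
  zero_mem' x := by rw [map_zero, zero_apply]
  smul_mem' c w hw x := by rw [map_smul, _root_.smul_apply, hw x, smul_zero]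

/-- The tangential part of `w ∈ T_{f p} M`, as a vector of `T_p S`: the vector `u` with
`⟨u, x⟩ = ⟨w, df x⟩` for all `x ∈ T_p S`. -/
def tangentialPart (g : LorentzianMetric m M) (gS : LorentzianMetric n S) (f : S → M) (p : S) :
    TangentSpace (𝓡 m) (f p) →L[ℝ] TangentSpace (𝓡 n) p :=
  (gS.inner p).inverse ∘L (mfderiv (𝓡 n) (𝓡 m) f p).precomp ℝ ∘L g.inner (f p)

/-- The normal part `π^⊥ w` of `w ∈ T_{f p} M`. -/
def normalPart (g : LorentzianMetric m M) (gS : LorentzianMetric n S) (f : S → M) (p : S)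
    (w : TangentSpace (𝓡 m) (f p)) : TangentSpace (𝓡 m) (f p) :=
  w - mfderiv (𝓡 n) (𝓡 m) f p (g.tangentialPart gS f p w)

/-- The second fundamental form `II(X, Y) = π^⊥ (∇_Y X)` of the submanifold `f : S → M` at `p`, where
`X` is extended to a vector field on `S` around `p`. -/
def secondFundamentalForm (g : LorentzianMetric m M) (gS : LorentzianMetric n S) (f : S → M) (p : S)
    (x y : TangentSpace (𝓡 n) p) : TangentSpace (𝓡 m) (f p) :=
  g.normalPart gS f p (g.covDerivAlong f (fun q ↦ mfderiv (𝓡 n) (𝓡 m) f q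
    (FiberBundle.extend (EuclideanSpace ℝ (Fin n)) x q)) p y)

variable {g : LorentzianMetric m M} {gS : LorentzianMetric n S} {f : S → M}

lemma IsIsometricEmbedding.tangentialPart_mfderiv (hf : IsIsometricEmbedding g gS f) {p : S}
    (u : TangentSpace (𝓡 n) p) :
    g.tangentialPart gS f p (mfderiv (𝓡 n) (𝓡 m) f p u) = u := by
  refine ((gS.isInvertible_inner p).inverse_apply_eq).2 (ContinuousLinearMap.ext fun z ↦ ?_)
  exact (hf.inner_eq p u z).symm

lemma IsIsometricEmbedding.normalPart_mem (hf : IsIsometricEmbedding g gS f) {p : S}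
    (w : TangentSpace (𝓡 m) (f p)) : g.normalPart gS f p w ∈ g.normalSpace n f p := by
  intro x
  have h : gS.inner p (g.tangentialPart gS f p w) =
      (mfderiv (𝓡 n) (𝓡 m) f p).precomp ℝ (g.inner (f p) w) :=
    ((gS.isInvertible_inner p).inverse_apply_eq.1 rfl).symm
  rw [normalPart, map_sub, sub_apply, ← hf.inner_eq, h]
  exact sub_self _

lemma IsIsometricEmbedding.normalPart_add_mfderiv (hf : IsIsometricEmbedding g gS f) {p : S}
    (w : TangentSpace (𝓡 m) (f p)) (u : TangentSpace (𝓡 n) p) :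
    g.normalPart gS f p (w + mfderiv (𝓡 n) (𝓡 m) f p u) = g.normalPart gS f p w := by
  rw [normalPart, normalPart, map_add, map_add, hf.tangentialPart_mfderiv]
  exact add_sub_add_right_eq_sub _ _ _

/-- The covariant derivative along `f` of a vector field tangent to `S` depends only on the value of
the vector field at the point, up to tangent vectors. -/
lemma exists_covDerivAlong_mfderiv (g : LorentzianMetric m M) {f : S → M} {p : S}
    (hf : ContMDiffAt (𝓡 n) (𝓡 m) ∞ f p) (x y : TangentSpace (𝓡 n) p) :
    ∃ w : TangentSpace (𝓡 m) (f p), ∀ X : Π q : S, TangentSpace (𝓡 n) q,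
      MDifferentiableAt (𝓡 n) (𝓡 n).tangent (fun y ↦ (⟨y, X y⟩ : TangentBundle (𝓡 n) S)) p →
      X p = x → ∃ u : TangentSpace (𝓡 n) p,
      g.covDerivAlong f (fun q ↦ mfderiv (𝓡 n) (𝓡 m) f q (X q)) p y =
        w + mfderiv (𝓡 n) (𝓡 m) f p u := by
  let t := trivializationAt (EuclideanSpace ℝ (Fin m)) (TangentSpace (𝓡 m)) (f p)
  let s := trivializationAt (EuclideanSpace ℝ (Fin n)) (TangentSpace (𝓡 n)) p
  have hs : p ∈ s.baseSet := FiberBundle.mem_baseSet_trivializationAt' p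
  have ht : f p ∈ t.baseSet := FiberBundle.mem_baseSet_trivializationAt' (f p)
  let c : S → EuclideanSpace ℝ (Fin n) →L[ℝ] EuclideanSpace ℝ (Fin m) := fun q ↦
    t.continuousLinearMapAt ℝ (f q) ∘L mfderiv (𝓡 n) (𝓡 m) f q ∘L s.symmL ℝ q
  have hc : MDifferentiableAt (𝓡 n) 𝓘(ℝ, EuclideanSpace ℝ (Fin n) →L[ℝ] EuclideanSpace ℝ (Fin m))
      c p := (hf.mfderiv_const (m := 1) (by norm_num; exact ENat.LEInfty.out)).mdifferentiableAt one_ne_zero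
  have hL' : ∀ u, t.symmL ℝ (f p) (t.continuousLinearMapAt ℝ (f p) u) = u :=
    t.symmL_continuousLinearMapAt (R := ℝ) ht
  refine ⟨t.symmL ℝ (f p) (mvfderiv (𝓡 n) c p y (s ⟨p, x⟩).2) +
    g.christoffel (f p) (mfderiv (𝓡 n) (𝓡 m) f p x) (mfderiv (𝓡 n) (𝓡 m) f p y), ?_⟩
  rintro X hX rfl
  rw [mdifferentiableAt_section] at hX
  refine ⟨s.symmL ℝ p (mvfderiv (𝓡 n) (fun q ↦ (s ⟨q, X q⟩).2) p y), ?_⟩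
  have hev : (fun q ↦ (t ⟨f q, mfderiv (𝓡 n) (𝓡 m) f q (X q)⟩).2) =ᶠ[nhds p]
      fun q ↦ c q (s ⟨q, X q⟩).2 := by
    filter_upwards [s.open_baseSet.mem_nhds hs,
      hf.continuousAt.preimage_mem_nhds (t.open_baseSet.mem_nhds ht)] with q hq hq'
    have h1 : s.symmL ℝ q (s ⟨q, X q⟩).2 = X q := by
      have := s.symmL_continuousLinearMapAt (R := ℝ) hq (X q)
      rwa [s.continuousLinearMapAt_apply (R := ℝ), s.coe_linearMapAt_of_mem (R := ℝ) hq] at this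
    change _ = t.continuousLinearMapAt ℝ (f q) (mfderiv (𝓡 n) (𝓡 m) f q
      (s.symmL ℝ q (s ⟨q, X q⟩).2))
    rw [h1, t.continuousLinearMapAt_apply (R := ℝ), t.coe_linearMapAt_of_mem (R := ℝ) hq']
  rw [covDerivAlong, add_apply, ContinuousLinearMap.comp_apply, mvfderiv_congr hev,
    mvfderiv_clm_apply hc hX, map_add]
  have h2 : t.symmL ℝ (f p) (c p (mvfderiv (𝓡 n) (fun q ↦ (s ⟨q, X q⟩).2) p y)) =
    mfderiv (𝓡 n) (𝓡 m) f p (s.symmL ℝ p (mvfderiv (𝓡 n) (fun q ↦ (s ⟨q, X q⟩).2) p y)) :=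
    hL' _
  rw [h2]
  exact add_right_comm _ _ _

/-- The second fundamental form does not depend on the extension of `X`. -/
lemma IsIsometricEmbedding.secondFundamentalForm_eq (hf : IsIsometricEmbedding g gS f) {p : S}
    {X : Π q : S, TangentSpace (𝓡 n) q}
    (hX : MDifferentiableAt (𝓡 n) (𝓡 n).tangent
      (fun y ↦ (⟨y, X y⟩ : TangentBundle (𝓡 n) S)) p) (y : TangentSpace (𝓡 n) p) :
    g.secondFundamentalForm gS f p (X p) y =
      g.normalPart gS f p (g.covDerivAlong f (fun q ↦ mfderiv (𝓡 n) (𝓡 m) f q (X q)) p y) := by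
  obtain ⟨w, hw⟩ := g.exists_covDerivAlong_mfderiv (hf.isSmoothEmbedding.contMDiff p) (X p) y
  obtain ⟨u, hu⟩ := hw X hX rfl
  obtain ⟨u', hu'⟩ := hw _
    (FiberBundle.mdifferentiableAt_extend (𝓡 n) (EuclideanSpace ℝ (Fin n)) (X p))
    (FiberBundle.extend_apply_self _ _)
  rw [secondFundamentalForm, hu, hu', hf.normalPart_add_mfderiv, hf.normalPart_add_mfderiv]

end Submanifold

section Killing

variable {m n : ℕ} {M : Type*} [TopologicalSpace M]
    [ChartedSpace (EuclideanSpace ℝ (Fin m)) M] [IsManifold (𝓡 m) ∞ M]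
    {S : Type*} [TopologicalSpace S]
    [ChartedSpace (EuclideanSpace ℝ (Fin n)) S] [IsManifold (𝓡 n) ∞ S]

/-- `K` is a smooth Killing vector field: `⟨∇_u K, v⟩ + ⟨u, ∇_v K⟩ = 0`. -/
structure IsKilling (g : LorentzianMetric m M) (K : Π x : M, TangentSpace (𝓡 m) x) : Prop where
  contMDiff : ContMDiff (𝓡 m) (𝓡 m).tangent ∞ (fun x ↦ (⟨x, K x⟩ : TangentBundle (𝓡 m) M))
  killing_eq (x : M) (u v : TangentSpace (𝓡 m) x) :
    g.inner x (g.leviCivita K x u) v + g.inner x u (g.leviCivita K x v) = 0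

/-- The matrix `𝒢_αβ = ⟨K_α, K_β⟩`. The index `0` stands for `t` and the index `1` for `φ`. -/
def gram (g : LorentzianMetric m M) (K : Fin 2 → Π x : M, TangentSpace (𝓡 m) x) (x : M) :
    Matrix (Fin 2) (Fin 2) ℝ :=
  Matrix.of fun α β ↦ g.inner x (K α x) (K β x)

/-- `K_t, K_φ` are two commuting Killing vector fields with `𝒢 = det 𝒢_αβ < 0`. -/
structure IsStationaryAxisymmetric (g : LorentzianMetric m M)
    (K : Fin 2 → Π x : M, TangentSpace (𝓡 m) x) : Prop where
  isKilling (α : Fin 2) : g.IsKilling (K α)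
  commute (α β : Fin 2) (x : M) : mlieBracket (𝓡 m) (K α) (K β) x = 0
  det_neg (x : M) : (g.gram K x).det < 0

/-- The constant components `ρ^α = (ρ, 1)`. -/
def rhoCoeff (ρ : ℝ) : Fin 2 → ℝ := ![ρ, 1]

/-- The vector field `ρ̂ = ρ^α K_α`. -/
def rhoHat (K : Fin 2 → Π x : M, TangentSpace (𝓡 m) x) (ρ : ℝ) (x : M) : TangentSpace (𝓡 m) x :=
  ∑ α, rhoCoeff ρ α • K α x

/-- The two-dimensional Levi-Civita tensor `ε_αβ` of `𝒢_αβ`, with `ε_tφ = √|𝒢|`. -/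
def epsilon (g : LorentzianMetric m M) (K : Fin 2 → Π x : M, TangentSpace (𝓡 m) x) (x : M) :
    Matrix (Fin 2) (Fin 2) ℝ :=
  √|(g.gram K x).det| • !![0, 1; -1, 0]

/-- The components `τ^α = 𝒢^αλ ε_λβ ρ^β`. -/
def tauCoeff (g : LorentzianMetric m M) (K : Fin 2 → Π x : M, TangentSpace (𝓡 m) x) (ρ : ℝ)
    (x : M) : Fin 2 → ℝ :=
  ((g.gram K x)⁻¹ * g.epsilon K x).mulVec (rhoCoeff ρ)

/-- The submanifold `f : S → M` is invariant: the fields `K_α` and `[K_α, K_β]` are tangent to it. -/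
structure IsInvariant (n : ℕ) {S : Type*} [TopologicalSpace S]
    [ChartedSpace (EuclideanSpace ℝ (Fin n)) S] (f : S → M)
    (K : Fin 2 → Π x : M, TangentSpace (𝓡 m) x) : Prop where
  tangent (α : Fin 2) (p : S) : K α (f p) ∈ Set.range (mfderiv (𝓡 n) (𝓡 m) f p)
  bracket_tangent (α β : Fin 2) (p : S) :
    mlieBracket (𝓡 m) (K α) (K β) (f p) ∈ Set.range (mfderiv (𝓡 n) (𝓡 m) f p)

/-- The restriction to `T_p S` of the orthogonal complement of `ρ̂`. -/
def rhoPerp (g : LorentzianMetric m M) (K : Fin 2 → Π x : M, TangentSpace (𝓡 m) x) (ρ : ℝ)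
    (n : ℕ) {S : Type*} [TopologicalSpace S]
    [ChartedSpace (EuclideanSpace ℝ (Fin n)) S] (f : S → M) (p : S) :
    Submodule ℝ (TangentSpace (𝓡 n) p) where
  carrier := {x | g.inner (f p) (rhoHat K ρ (f p)) (mfderiv (𝓡 n) (𝓡 m) f p x) = 0}
  add_mem' {v w} hv hw := by
    change g.inner _ _ _ = 0 at hv hw ⊢
    rw [map_add, map_add, hv, hw, add_zero]
  zero_mem' := by
    change g.inner _ _ _ = 0
    rw [map_zero, map_zero]
  smul_mem' c w hw := by
    change g.inner _ _ _ = 0 at hw ⊢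
    rw [map_smul, map_smul, hw, smul_zero]

/-- The submanifold `f : S → M` is totally `V` umbilic with factor the normal vector field `H`:
`II(X, Y) = H ⟨X, Y⟩` for all `X, Y ∈ V`, where `V` is a subbundle of `TS`. -/
structure IsTotallyUmbilicOn (g : LorentzianMetric m M) (gS : LorentzianMetric n S) (f : S → M)
    (V : Π p : S, Submodule ℝ (TangentSpace (𝓡 n) p))
    (H : Π p : S, TangentSpace (𝓡 m) (f p)) : Prop where
  normal (p : S) : H p ∈ g.normalSpace n f p
  secondFundamentalForm_eq (p : S) (x y : TangentSpace (𝓡 n) p) (hx : x ∈ V p) (hy : y ∈ V p) :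
    g.secondFundamentalForm gS f p x y = gS.inner p x y • H p

/-- `ξ_1, ..., ξ_{m-n}` is a frame of unit normals (of norm `±1`, pairwise orthogonal) at `p`. -/
structure IsNormalFrame (g : LorentzianMetric m M) (n : ℕ) {S : Type*} [TopologicalSpace S]
    [ChartedSpace (EuclideanSpace ℝ (Fin n)) S] (f : S → M) (p : S)
    (ξ : Fin (m - n) → TangentSpace (𝓡 m) (f p)) : Prop where
  normal (A : Fin (m - n)) : ξ A ∈ g.normalSpace n f p
  unit (A : Fin (m - n)) : |g.inner (f p) (ξ A) (ξ A)| = 1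
  orthogonal (A B : Fin (m - n)) (h : A ≠ B) : g.inner (f p) (ξ A) (ξ B) = 0

/-- The normal derivative `∇^⊥ φ = ∑_A ε_A (∇_{ξ_A} φ) ξ_A`, with `ε_A = ⟨ξ_A, ξ_A⟩`, of a
function `φ` on `M`. -/
def normalGrad (g : LorentzianMetric m M) {k : ℕ} {x : M} (ξ : Fin k → TangentSpace (𝓡 m) x)
    (φ : M → ℝ) : TangentSpace (𝓡 m) x :=
  ∑ A, (g.inner x (ξ A) (ξ A) * mvfderiv (𝓡 m) φ x (ξ A)) • ξ A

/-- The vector `- ∑_A ε_A ⟨∇_{ξ_A} K, v⟩ ξ_A`, with `ε_A = ⟨ξ_A, ξ_A⟩`. -/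
def mixedBlock (g : LorentzianMetric m M) {k : ℕ} {x : M} (ξ : Fin k → TangentSpace (𝓡 m) x)
    (K : Π x : M, TangentSpace (𝓡 m) x) (v : TangentSpace (𝓡 m) x) : TangentSpace (𝓡 m) x :=
  -∑ A, (g.inner x (ξ A) (ξ A) * g.inner x (g.leviCivita K x (ξ A)) v) • ξ A

/-- The vector-valued matrix `ℳ_αβ = ½ ∇^⊥(𝒢⁻¹ 𝒢_αβ) - 𝒢⁻¹ 𝒢_αβ H`. -/
def masterMatrix (g : LorentzianMetric m M) (K : Fin 2 → Π x : M, TangentSpace (𝓡 m) x) {k : ℕ}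
    {x : M} (ξ : Fin k → TangentSpace (𝓡 m) x) (H : TangentSpace (𝓡 m) x) :
    Matrix (Fin 2) (Fin 2) (TangentSpace (𝓡 m) x) :=
  Matrix.of fun α β ↦
    (1 / 2 : ℝ) • g.normalGrad ξ (fun y ↦ (g.gram K y).det⁻¹ * g.gram K y α β) -
      ((g.gram K x).det⁻¹ * g.gram K x α β) • H

/-- The contraction `ρ^α ℳ_αβ ρ^β`. -/
def masterForm (g : LorentzianMetric m M) (K : Fin 2 → Π x : M, TangentSpace (𝓡 m) x) (ρ : ℝ)
    {k : ℕ} {x : M} (ξ : Fin k → TangentSpace (𝓡 m) x) (H : TangentSpace (𝓡 m) x) :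
    TangentSpace (𝓡 m) x :=
  ∑ α, ∑ β, (rhoCoeff ρ α * rhoCoeff ρ β) • g.masterMatrix K ξ H α β

/-- `b` is a basis `{K_α, e_a}` of `T_p S`, where the `e_a` are orthogonal to `K_t` and `K_φ`. -/
structure IsAdaptedBasis (g : LorentzianMetric m M)
    (K : Fin 2 → Π x : M, TangentSpace (𝓡 m) x) (f : S → M) (p : S)
    (b : Module.Basis (Fin 2 ⊕ Fin (n - 2)) ℝ (TangentSpace (𝓡 n) p)) : Prop where
  killing (α : Fin 2) : mfderiv (𝓡 n) (𝓡 m) f p (b (.inl α)) = K α (f p)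
  orthogonal (α : Fin 2) (a : Fin (n - 2)) :
    g.inner (f p) (K α (f p)) (mfderiv (𝓡 n) (𝓡 m) f p (b (.inr a))) = 0

end Killing

end LorentzianMetric

end

/-! Since `K α` is tangent to `S`, it can serve as its own extension, so II(K_α, y) is the normal
part of ∇_y K_α. Tested against a normal ξ, the Killing equation turns ⟨∇_y K_α, ξ⟩ into -⟨∇_ξ K_α,
y⟩; expanding in the frame ξ_A gives every block that involves a Killing vector
(`IsKilling.secondFundamentalForm_eq`). For y = K_β, commutation together with the two Killing
equations gives ξ(𝒢_αβ) = 2⟨∇_ξ K_α, K_β⟩ (`mvfderiv_gram`), hence the block -½∇^⊥𝒢_αβ. The lower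
left block follows from the symmetry of II.

The umbilic hypothesis is used only on vectors orthogonal to ρ̂. These include the e_a and also τ =
τ^α K_α, since τ is ρ̂ rotated in the Killing plane. The pairs (e_a, e_b), (τ, e_a) and (τ, τ) give
respectively the last block, the mixed condition, and -½ τ^α τ^β ∇^⊥𝒢_αβ = ⟨τ, τ⟩ H.

The last equation is the master equation in disguise. Put φ = 𝒢⁻¹⟨ρ̂, ρ̂⟩. As ρ^α is constant, the
contracted master form is ½∇^⊥φ - φH (`masterForm_eq`). For 2×2 matrices 𝒢⁻¹𝒢_αβ is the inverse
matrix 𝒢^αβ conjugated by the constant antisymmetric symbol, so d(G⁻¹) = -G⁻¹ dG G⁻¹ yields dφ = 𝒢⁻¹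
τ^α τ^β d𝒢_αβ, while φ = -𝒢⁻¹⟨τ, τ⟩ because 𝒢 < 0. Substituting both gives zero, whether or not ρ̂
is null. Where ρ̂ is not null, dividing by φ turns ∇^⊥φ into the gradient of ln|φ|. -/

namespace LorentzianMetric

/-! ### Symmetry and linearity of the second fundamental form -/

section Symmetry

variable {m n : ℕ} {M : Type*} [TopologicalSpace M]
    [ChartedSpace (EuclideanSpace ℝ (Fin m)) M] [IsManifold (𝓡 m) ∞ M]
    {S : Type*} [TopologicalSpace S]
    [ChartedSpace (EuclideanSpace ℝ (Fin n)) S] [IsManifold (𝓡 n) ∞ S]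

/-- The differential of `f` in the trivializations of the tangent bundles around `p` and `f p`. -/
noncomputable def differentialInCoordinates (m n : ℕ) {M : Type*} [TopologicalSpace M]
    [ChartedSpace (EuclideanSpace ℝ (Fin m)) M] [IsManifold (𝓡 m) ∞ M]
    {S : Type*} [TopologicalSpace S]
    [ChartedSpace (EuclideanSpace ℝ (Fin n)) S] [IsManifold (𝓡 n) ∞ S] (f : S → M) (p q : S) :
    EuclideanSpace ℝ (Fin n) →L[ℝ] EuclideanSpace ℝ (Fin m) :=
  (trivializationAt (EuclideanSpace ℝ (Fin m)) (TangentSpace (𝓡 m)) (f p)).continuousLinearMapAt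
      ℝ (f q) ∘L mfderiv (𝓡 n) (𝓡 m) f q ∘L
    (trivializationAt (EuclideanSpace ℝ (Fin n)) (TangentSpace (𝓡 n)) p).symmL ℝ q

lemma mdifferentiableAt_differentialInCoordinates {f : S → M} {p : S}
    (hf : ContMDiffAt (𝓡 n) (𝓡 m) ∞ f p) :
    MDifferentiableAt (𝓡 n) 𝓘(ℝ, EuclideanSpace ℝ (Fin n) →L[ℝ] EuclideanSpace ℝ (Fin m))
      (differentialInCoordinates m n f p) p :=
  (hf.mfderiv_const (m := 1) (by norm_num; exact ENat.LEInfty.out)).mdifferentiableAt one_ne_zero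

/-- The trivializations of the tangent bundles are the differentials of the charts, so this is the
chain rule. It makes the derivative of the differential an ordinary second derivative, to which
Schwarz's theorem applies. -/
lemma differentialInCoordinates_eventuallyEq {f : S → M} (hf : ContMDiff (𝓡 n) (𝓡 m) ∞ f) (p : S) :
    differentialInCoordinates m n f p =ᶠ[nhds p] fun q ↦
      fderiv ℝ (writtenInExtChartAt (𝓡 n) (𝓡 m) p f) (extChartAt (𝓡 n) p q) := by
  filter_upwards [extChartAt_source_mem_nhds (I := 𝓡 n) p,
    hf.continuous.continuousAt.preimage_mem_nhds
      (extChartAt_source_mem_nhds (I := 𝓡 m) (f p))] with q hq hq'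
  have hqc : q ∈ (chartAt (EuclideanSpace ℝ (Fin n)) p).source := by rwa [← extChartAt_source (𝓡 n)]
  have hqc' : f q ∈ (chartAt (EuclideanSpace ℝ (Fin m)) (f p)).source := by
    rw [← extChartAt_source (𝓡 m)]; exact hq'
  rw [differentialInCoordinates, TangentBundle.continuousLinearMapAt_trivializationAt hqc',
    TangentBundle.symmL_trivializationAt hqc, ModelWithCorners.range_eq_univ, mfderivWithin_univ]
  have hl : (extChartAt (𝓡 n) p).symm (extChartAt (𝓡 n) p q) = q := (extChartAt (𝓡 n) p).left_inv hq
  have h1 : HasMFDerivAt 𝓘(ℝ, EuclideanSpace ℝ (Fin n)) (𝓡 n) (extChartAt (𝓡 n) p).symm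
      (extChartAt (𝓡 n) p q) (mfderiv 𝓘(ℝ, EuclideanSpace ℝ (Fin n)) (𝓡 n) (extChartAt (𝓡 n) p).symm
      (extChartAt (𝓡 n) p q)) := by
    have := mdifferentiableWithinAt_extChartAt_symm (I := 𝓡 n) ((extChartAt (𝓡 n) p).map_source hq)
    rw [ModelWithCorners.range_eq_univ, mdifferentiableWithinAt_univ] at this
    exact this.hasMFDerivAt
  have h2 : HasMFDerivAt (𝓡 n) (𝓡 m) f ((extChartAt (𝓡 n) p).symm (extChartAt (𝓡 n) p q))
      (mfderiv (𝓡 n) (𝓡 m) f q) := by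
    rw [hl]
    exact (hf.mdifferentiableAt (by simp)).hasMFDerivAt
  have h3 : HasMFDerivAt (𝓡 m) 𝓘(ℝ, EuclideanSpace ℝ (Fin m)) (extChartAt (𝓡 m) (f p))
      (f ((extChartAt (𝓡 n) p).symm (extChartAt (𝓡 n) p q)))
      (mfderiv (𝓡 m) 𝓘(ℝ, EuclideanSpace ℝ (Fin m)) (extChartAt (𝓡 m) (f p)) (f q)) := by
    rw [hl]
    exact (mdifferentiableAt_extChartAt hqc').hasMFDerivAt
  have h := HasMFDerivAt.comp (f := f ∘ (extChartAt (𝓡 n) p).symm) (extChartAt (𝓡 n) p q) h3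
    (h2.comp _ h1)
  rw [← mfderiv_eq_fderiv]
  exact h.mfderiv.symm

/-- The second derivative of `f` in the charts around `p` and `f p` is symmetric. -/
lemma mvfderiv_differentialInCoordinates_symm {f : S → M} (hf : ContMDiff (𝓡 n) (𝓡 m) ∞ f) (p : S)
    (x y : TangentSpace (𝓡 n) p) :
    mvfderiv (𝓡 n) (differentialInCoordinates m n f p) p y
        (trivializationAt (EuclideanSpace ℝ (Fin n)) (TangentSpace (𝓡 n)) p ⟨p, x⟩).2 =
      mvfderiv (𝓡 n) (differentialInCoordinates m n f p) p x
        (trivializationAt (EuclideanSpace ℝ (Fin n)) (TangentSpace (𝓡 n)) p ⟨p, y⟩).2 := by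
  let φ := extChartAt (𝓡 n) p
  let F := writtenInExtChartAt (𝓡 n) (𝓡 m) p f
  have hF : ContDiffAt ℝ ∞ F (φ p) := by
    have := (contMDiffAt_iff.1 (hf p)).2
    rwa [ModelWithCorners.range_eq_univ, contDiffWithinAt_univ] at this
  have hs : ∀ z : TangentSpace (𝓡 n) p,
      (trivializationAt (EuclideanSpace ℝ (Fin n)) (TangentSpace (𝓡 n)) p ⟨p, z⟩).2 =
        mfderiv (𝓡 n) 𝓘(ℝ, EuclideanSpace ℝ (Fin n)) φ p z := fun z ↦ by
    have h := congr_fun ((trivializationAt (EuclideanSpace ℝ (Fin n)) (TangentSpace (𝓡 n)) p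
      ).continuousLinearMapAt_apply (R := ℝ) (b := p)) z
    rw [Trivialization.coe_linearMapAt_of_mem _ (FiberBundle.mem_baseSet_trivializationAt' p)] at h
    exact h.symm.trans
      congr($(TangentBundle.continuousLinearMapAt_trivializationAt (mem_chart_source _ p)) z)
  have hd : DifferentiableAt ℝ (fderiv ℝ F) (φ p) :=
    (hF.fderiv_right (m := 1) (by norm_num; exact ENat.LEInfty.out)).differentiableAt one_ne_zero
  -- Chain rule: near `p` the differential in coordinates is `fderiv ℝ F` composed with the chart.
  have key : ∀ z : TangentSpace (𝓡 n) p,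
      mvfderiv (𝓡 n) (differentialInCoordinates m n f p) p z =
        fderiv ℝ (fderiv ℝ F) (φ p) (mfderiv (𝓡 n) 𝓘(ℝ, EuclideanSpace ℝ (Fin n)) φ p z) := by
    intro z
    rw [mvfderiv_congr (differentialInCoordinates_eventuallyEq hf p)]
    have h1 := hasMFDerivAt_iff_hasFDerivAt.2 hd.hasFDerivAt
    have h2 := (mdifferentiableAt_extChartAt (I := 𝓡 n) (mem_chart_source _ p)).hasMFDerivAt
    exact congr($((h1.comp p h2).mfderiv) z)
  rw [key, key, hs, hs]
  exact hF.isSymmSndFDerivAt (by simp; exact ENat.LEInfty.out) _ _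

/-- The extension of `x` is constant in the trivialization, so only the Hessian of `f` and a
Christoffel term remain. Both are symmetric in `x` and `y`, which is the source of the symmetry of
II. -/
lemma covDerivAlong_mfderiv_extend (g : LorentzianMetric m M) {f : S → M} {p : S}
    (hf : ContMDiffAt (𝓡 n) (𝓡 m) ∞ f p) (x y : TangentSpace (𝓡 n) p) :
    g.covDerivAlong f (fun q ↦ mfderiv (𝓡 n) (𝓡 m) f q
        (FiberBundle.extend (EuclideanSpace ℝ (Fin n)) x q)) p y =
      (trivializationAt (EuclideanSpace ℝ (Fin m)) (TangentSpace (𝓡 m)) (f p)).symmL ℝ (f p)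
        (mvfderiv (𝓡 n) (differentialInCoordinates m n f p) p y
          (trivializationAt (EuclideanSpace ℝ (Fin n)) (TangentSpace (𝓡 n)) p ⟨p, x⟩).2) +
      g.christoffel (f p) (mfderiv (𝓡 n) (𝓡 m) f p x) (mfderiv (𝓡 n) (𝓡 m) f p y) := by
  let t := trivializationAt (EuclideanSpace ℝ (Fin m)) (TangentSpace (𝓡 m)) (f p)
  let s := trivializationAt (EuclideanSpace ℝ (Fin n)) (TangentSpace (𝓡 n)) p
  have hs : p ∈ s.baseSet := FiberBundle.mem_baseSet_trivializationAt' p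
  have ht : f p ∈ t.baseSet := FiberBundle.mem_baseSet_trivializationAt' (f p)
  have hev : (fun q ↦ (t ⟨f q, mfderiv (𝓡 n) (𝓡 m) f q
      (FiberBundle.extend (EuclideanSpace ℝ (Fin n)) x q)⟩).2) =ᶠ[nhds p]
      fun q ↦ differentialInCoordinates m n f p q (s ⟨p, x⟩).2 := by
    filter_upwards [s.open_baseSet.mem_nhds hs,
      hf.continuousAt.preimage_mem_nhds (t.open_baseSet.mem_nhds ht)] with q hq hq'
    have h1 : s.symmL ℝ q (s ⟨p, x⟩).2 = FiberBundle.extend (EuclideanSpace ℝ (Fin n)) x q :=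
      s.symmL_apply (R := ℝ) hq _
    change _ = t.continuousLinearMapAt ℝ (f q) (mfderiv (𝓡 n) (𝓡 m) f q
      (s.symmL ℝ q (s ⟨p, x⟩).2))
    rw [h1, t.continuousLinearMapAt_apply (R := ℝ), t.coe_linearMapAt_of_mem (R := ℝ) hq']
  rw [covDerivAlong, add_apply, ContinuousLinearMap.comp_apply, mvfderiv_congr hev,
    mvfderiv_clm_apply (mdifferentiableAt_differentialInCoordinates hf) mdifferentiableAt_const,
    mvfderiv_const, FiberBundle.extend_apply_self, zero_apply, map_zero, add_zero]
  rfl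

/-- The second fundamental form is symmetric. -/
lemma secondFundamentalForm_symm (g : LorentzianMetric m M) (gS : LorentzianMetric n S) {f : S → M}
    (hf : ContMDiff (𝓡 n) (𝓡 m) ∞ f) {p : S} (x y : TangentSpace (𝓡 n) p) :
    g.secondFundamentalForm gS f p x y = g.secondFundamentalForm gS f p y x := by
  rw [secondFundamentalForm, secondFundamentalForm, g.covDerivAlong_mfderiv_extend (hf p),
    g.covDerivAlong_mfderiv_extend (hf p), mvfderiv_differentialInCoordinates_symm hf,
    christoffel_symm]

lemma normalPart_add (g : LorentzianMetric m M) (gS : LorentzianMetric n S) (f : S → M) (p : S)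
    (v w : TangentSpace (𝓡 m) (f p)) :
    g.normalPart gS f p (v + w) = g.normalPart gS f p v + g.normalPart gS f p w := by
  simp only [normalPart, map_add]
  exact add_sub_add_comm _ _ _ _

lemma normalPart_smul (g : LorentzianMetric m M) (gS : LorentzianMetric n S) (f : S → M) (p : S)
    (c : ℝ) (w : TangentSpace (𝓡 m) (f p)) :
    g.normalPart gS f p (c • w) = c • g.normalPart gS f p w := by
  simp only [normalPart, map_smul, smul_sub]

lemma secondFundamentalForm_add_right (g : LorentzianMetric m M) (gS : LorentzianMetric n S)
    (f : S → M) {p : S} (x y z : TangentSpace (𝓡 n) p) :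
    g.secondFundamentalForm gS f p x (y + z) =
      g.secondFundamentalForm gS f p x y + g.secondFundamentalForm gS f p x z := by
  simp only [secondFundamentalForm, map_add, normalPart_add]

lemma secondFundamentalForm_smul_right (g : LorentzianMetric m M) (gS : LorentzianMetric n S)
    (f : S → M) {p : S} (c : ℝ) (x y : TangentSpace (𝓡 n) p) :
    g.secondFundamentalForm gS f p x (c • y) = c • g.secondFundamentalForm gS f p x y := by
  simp only [secondFundamentalForm, map_smul, normalPart_smul]

end Symmetry

end LorentzianMetric

namespace LorentzianMetric

/-! ### Ambient vector fields tangent to the submanifold -/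

section TangentField

variable {m n : ℕ} {M : Type*} [TopologicalSpace M]
    [ChartedSpace (EuclideanSpace ℝ (Fin m)) M] [IsManifold (𝓡 m) ∞ M]
    {S : Type*} [TopologicalSpace S]
    [ChartedSpace (EuclideanSpace ℝ (Fin n)) S] [IsManifold (𝓡 n) ∞ S]

/-- Nondegeneracy on the whole trivialization domain, not only at the centre, is what allows the
inverse of the metric coefficients to be used at nearby points. -/
lemma isInvertible_coeff (g : LorentzianMetric m M) {x₀ x : M}
    (hx : x ∈ (trivializationAt (EuclideanSpace ℝ (Fin m)) (TangentSpace (𝓡 m)) x₀).baseSet) :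
    (g.coeff x₀ x).IsInvertible := by
  let t := trivializationAt (EuclideanSpace ℝ (Fin m)) (TangentSpace (𝓡 m)) x₀
  have hinj : Function.Injective (g.coeff x₀ x) := by
    rw [injective_iff_map_eq_zero]
    intro u hu
    have h0 : t.symmL ℝ x u = 0 := by
      refine g.ext_inner fun w ↦ ?_
      have h1 : g.inner x (t.symmL ℝ x u) (t.symmL ℝ x (t.continuousLinearMapAt ℝ x w)) = 0 :=
        congr($hu (t.continuousLinearMapAt ℝ x w))
      rw [t.symmL_continuousLinearMapAt (R := ℝ) hx] at h1
      rw [h1, map_zero, zero_apply]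
    rw [← t.continuousLinearMapAt_symmL (R := ℝ) hx u, h0, map_zero]
  have hd : Module.finrank ℝ (EuclideanSpace ℝ (Fin m)) =
      Module.finrank ℝ (EuclideanSpace ℝ (Fin m) →L[ℝ] ℝ) := by
    rw [← LinearEquiv.finrank_eq (LinearMap.toContinuousLinearMap (𝕜 := ℝ)
      (E := EuclideanSpace ℝ (Fin m)) (F' := ℝ))]
    exact (Subspace.dual_finrank_eq).symm
  let e := LinearEquiv.ofInjectiveOfFinrankEq (g.coeff x₀ x).toLinearMap hinj hd
  refine ⟨e.toContinuousLinearEquiv, ?_⟩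
  ext u v
  rfl

variable {g : LorentzianMetric m M} {gS : LorentzianMetric n S} {f : S → M}

/-- The tangential part of a differentiable vector field that is tangent to `S` is a differentiable
vector field on `S`. -/
lemma IsIsometricEmbedding.mdifferentiableAt_tangentialPart (hf : IsIsometricEmbedding g gS f)
    {p : S} {X : Π x : M, TangentSpace (𝓡 m) x}
    (hX : MDifferentiableAt (𝓡 m) (𝓡 m).tangent
      (fun y ↦ (⟨y, X y⟩ : TangentBundle (𝓡 m) M)) (f p))
    (hXt : ∀ q, X (f q) ∈ Set.range (mfderiv (𝓡 n) (𝓡 m) f q)) :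
    MDifferentiableAt (𝓡 n) (𝓡 n).tangent
      (fun q ↦ (⟨q, g.tangentialPart gS f q (X (f q))⟩ : TangentBundle (𝓡 n) S)) p := by
  let t := trivializationAt (EuclideanSpace ℝ (Fin m)) (TangentSpace (𝓡 m)) (f p)
  let s := trivializationAt (EuclideanSpace ℝ (Fin n)) (TangentSpace (𝓡 n)) p
  have hs : p ∈ s.baseSet := FiberBundle.mem_baseSet_trivializationAt' p
  have ht : f p ∈ t.baseSet := FiberBundle.mem_baseSet_trivializationAt' (f p)
  have hfd : MDifferentiableAt (𝓡 n) (𝓡 m) f p :=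
    (hf.isSmoothEmbedding.contMDiff p).mdifferentiableAt (by simp)
  rw [mdifferentiableAt_section] at hX ⊢
  -- Inversion of operators is smooth at an invertible one, so the inverse metric of `S` is
  -- differentiable in coordinates.
  have hinv : MDifferentiableAt (𝓡 n) 𝓘(ℝ, (EuclideanSpace ℝ (Fin n) →L[ℝ] ℝ) →L[ℝ]
      EuclideanSpace ℝ (Fin n)) (fun q ↦ (gS.coeff p q).inverse) p :=
    ((gS.isInvertible_coeff hs).contDiffAt_map_inverse (n := 1)).differentiableAt
      one_ne_zero |>.comp_mdifferentiableAt (gS.mdifferentiableAt_coeff p)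
  -- The covector w ↦ ⟨X, df w⟩ in coordinates. Raising its index with the metric of `S` gives the
  -- tangential part of `X`.
  have hcov : MDifferentiableAt (𝓡 n) 𝓘(ℝ, EuclideanSpace ℝ (Fin n) →L[ℝ] ℝ)
      (fun q ↦ (g.coeff (f p) (f q) (t ⟨f q, X (f q)⟩).2).comp
        (differentialInCoordinates m n f p q)) p :=
    (((g.mdifferentiableAt_coeff (f p)).comp p hfd).clm_apply (hX.comp p hfd)).clm_comp
      (mdifferentiableAt_differentialInCoordinates (hf.isSmoothEmbedding.contMDiff p))
  refine (hinv.clm_apply hcov).congr_of_eventuallyEq ?_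
  filter_upwards [s.open_baseSet.mem_nhds hs,
    hfd.continuousAt.preimage_mem_nhds (t.open_baseSet.mem_nhds ht)] with q hq hq'
  obtain ⟨u, hu⟩ := hXt q
  rw [← hu, hf.tangentialPart_mfderiv, eq_comm, (gS.isInvertible_coeff hq).inverse_apply_eq]
  refine ContinuousLinearMap.ext fun w ↦ ?_
  have h1 : s.symmL ℝ q (s ⟨q, u⟩).2 = u := by
    have := s.symmL_continuousLinearMapAt (R := ℝ) hq u
    rwa [s.continuousLinearMapAt_apply (R := ℝ), s.coe_linearMapAt_of_mem (R := ℝ) hq] at this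
  have h2 : gS.coeff p q (s ⟨q, u⟩).2 w =
      g.inner (f q) (mfderiv (𝓡 n) (𝓡 m) f q u) (mfderiv (𝓡 n) (𝓡 m) f q (s.symmL ℝ q w)) := by
    rw [← hf.inner_eq]
    change gS.inner q (s.symmL ℝ q (s ⟨q, u⟩).2) (s.symmL ℝ q w) = _
    rw [h1]
  have h3 : differentialInCoordinates m n f p q w =
      (t ⟨f q, mfderiv (𝓡 n) (𝓡 m) f q (s.symmL ℝ q w)⟩).2 := by
    change t.continuousLinearMapAt ℝ (f q) _ = _
    rw [t.continuousLinearMapAt_apply (R := ℝ), t.coe_linearMapAt_of_mem (R := ℝ) hq']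
    rfl
  rw [ContinuousLinearMap.comp_apply, h3, g.coeff_apply hq']
  exact h2.symm

/-- The second fundamental form on a vector field of `M` that is tangent to `S`. -/
lemma IsIsometricEmbedding.secondFundamentalForm_eq_normalPart (hf : IsIsometricEmbedding g gS f)
    {p : S} {X : Π x : M, TangentSpace (𝓡 m) x}
    (hX : MDifferentiableAt (𝓡 m) (𝓡 m).tangent
      (fun y ↦ (⟨y, X y⟩ : TangentBundle (𝓡 m) M)) (f p))
    (hXt : ∀ q, X (f q) ∈ Set.range (mfderiv (𝓡 n) (𝓡 m) f q)) {x : TangentSpace (𝓡 n) p}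
    (hx : mfderiv (𝓡 n) (𝓡 m) f p x = X (f p)) (y : TangentSpace (𝓡 n) p) :
    g.secondFundamentalForm gS f p x y =
      g.normalPart gS f p (g.leviCivita X (f p) (mfderiv (𝓡 n) (𝓡 m) f p y)) := by
  -- Tangency at every point of `S` makes the tangential part a vector field on `S` whose image
  -- under df is `X` itself; it is thus an admissible extension in the definition of II.
  have hk : ∀ q, mfderiv (𝓡 n) (𝓡 m) f q (g.tangentialPart gS f q (X (f q))) = X (f q) := by
    intro q
    obtain ⟨u, hu⟩ := hXt q
    rw [← hu, hf.tangentialPart_mfderiv]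
  have h := hf.secondFundamentalForm_eq (hf.mdifferentiableAt_tangentialPart hX hXt) y
  simp only [hk] at h
  rw [← hx, hf.tangentialPart_mfderiv] at h
  rw [h, g.covDerivAlong_comp ((hf.isSmoothEmbedding.contMDiff p).mdifferentiableAt (by simp)) hX]

/-! ### Expansion of normal vectors in an orthonormal frame -/

lemma IsIsometricEmbedding.mfderiv_injective (hf : IsIsometricEmbedding g gS f) (p : S) :
    Function.Injective (mfderiv (𝓡 n) (𝓡 m) f p) :=
  Function.LeftInverse.injective (g := g.tangentialPart gS f p) hf.tangentialPart_mfderiv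

/-- A normal vector is determined by its scalar products with a normal frame. -/
lemma IsIsometricEmbedding.eq_zero_of_mem_normalSpace (hf : IsIsometricEmbedding g gS f) {p : S}
    {ξ : Fin (m - n) → TangentSpace (𝓡 m) (f p)} (hξ : g.IsNormalFrame n f p ξ)
    {w : TangentSpace (𝓡 m) (f p)} (hw : w ∈ g.normalSpace n f p)
    (h : ∀ A, g.inner (f p) w (ξ A) = 0) : w = 0 := by
  have : FiniteDimensional ℝ (TangentSpace (𝓡 n) p) :=
    inferInstanceAs (FiniteDimensional ℝ (EuclideanSpace ℝ (Fin n)))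
  have : FiniteDimensional ℝ (TangentSpace (𝓡 m) (f p)) :=
    inferInstanceAs (FiniteDimensional ℝ (EuclideanSpace ℝ (Fin m)))
  have hdn : Module.finrank ℝ (TangentSpace (𝓡 n) p) = n :=
    finrank_euclideanSpace_fin (𝕜 := ℝ) (n := n)
  have hdm : Module.finrank ℝ (TangentSpace (𝓡 m) (f p)) = m :=
    finrank_euclideanSpace_fin (𝕜 := ℝ) (n := m)
  let D : TangentSpace (𝓡 n) p →ₗ[ℝ] TangentSpace (𝓡 m) (f p) :=
    (mfderiv (𝓡 n) (𝓡 m) f p).toLinearMap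
  let N : (Fin (m - n) → ℝ) →ₗ[ℝ] TangentSpace (𝓡 m) (f p) := Fintype.linearCombination ℝ ξ
  have hN : ∀ c A, g.inner (f p) (N c) (ξ A) = c A * g.inner (f p) (ξ A) (ξ A) := by
    intro c A
    rw [Fintype.linearCombination_apply, map_sum, _root_.sum_apply, Finset.sum_eq_single A]
    · rw [map_smul]; rfl
    · intro B _ hB
      rw [map_smul, _root_.smul_apply, hξ.orthogonal B A hB, smul_zero]
    · simp
  have hD : ∀ x A, g.inner (f p) (D x) (ξ A) = 0 := fun x A ↦ by
    rw [g.symm]; exact hξ.normal A x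
  have hDinj : Function.Injective D := hf.mfderiv_injective p
  -- Needed because `m - n` is truncated subtraction: the count n + (m - n) = m below requires it.
  have hle : n ≤ m := by
    have := LinearMap.finrank_le_finrank_of_injective hDinj
    rwa [hdn, hdm] at this
  -- Pairing with ξ_A isolates the coefficient `c A`, as ⟨ξ_A, ξ_A⟩ ≠ 0. With the dimension count,
  -- tangent vectors and the ξ_A therefore span the whole ambient tangent space.
  have hinj : Function.Injective (D.coprod N) := by
    rw [injective_iff_map_eq_zero]
    rintro ⟨x, c⟩ hxc
    rw [LinearMap.coprod_apply] at hxc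
    have hc : c = 0 := by
      funext A
      have h1 : g.inner (f p) (D x + N c) (ξ A) = 0 := by rw [hxc, map_zero, zero_apply]
      rw [map_add, add_apply, hD, hN, zero_add, mul_eq_zero] at h1
      refine h1.resolve_right fun h3 ↦ ?_
      have := hξ.unit A
      simp [h3] at this
    have hx : D x = 0 := by simpa [hc] using hxc
    rw [hc, hDinj (hx.trans (map_zero D).symm)]
    rfl
  have hsurj : Function.Surjective (D.coprod N) := by
    refine (LinearMap.injective_iff_surjective_of_finrank_eq_finrank ?_).1 hinj
    rw [Module.finrank_prod, hdn, hdm, Module.finrank_fin_fun]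
    omega
  refine g.ext_inner fun v ↦ ?_
  rw [map_zero, zero_apply]
  obtain ⟨⟨x, c⟩, rfl⟩ := hsurj v
  rw [LinearMap.coprod_apply, Fintype.linearCombination_apply, map_add, map_sum]
  simp only [map_smul, h, smul_zero, Finset.sum_const_zero, add_zero]
  exact hw x

/-- The expansion of the normal part of a vector in a normal frame. -/
lemma IsIsometricEmbedding.normalPart_eq_sum (hf : IsIsometricEmbedding g gS f) {p : S}
    {ξ : Fin (m - n) → TangentSpace (𝓡 m) (f p)} (hξ : g.IsNormalFrame n f p ξ)
    (w : TangentSpace (𝓡 m) (f p)) :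
    g.normalPart gS f p w = ∑ A, (g.inner (f p) (ξ A) (ξ A) * g.inner (f p) w (ξ A)) • ξ A := by
  rw [← sub_eq_zero]
  refine hf.eq_zero_of_mem_normalSpace hξ (Submodule.sub_mem _ (hf.normalPart_mem w)
    (Submodule.sum_mem _ fun A _ ↦ Submodule.smul_mem _ _ (hξ.normal A))) fun A ↦ ?_
  have h1 : g.inner (f p) (g.normalPart gS f p w) (ξ A) = g.inner (f p) w (ξ A) := by
    rw [normalPart, map_sub, sub_apply,
      g.symm _ (mfderiv (𝓡 n) (𝓡 m) f p (g.tangentialPart gS f p w)) (ξ A), hξ.normal A, sub_zero]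
  -- ε_A² = 1, so ε_A serves as its own inverse in the expansion.
  have hsq : g.inner (f p) (ξ A) (ξ A) * g.inner (f p) (ξ A) (ξ A) = 1 := by
    rw [← abs_mul_abs_self, hξ.unit A, one_mul]
  rw [map_sub, sub_apply, h1, map_sum, _root_.sum_apply, Finset.sum_eq_single A]
  · rw [map_smul, _root_.smul_apply, smul_eq_mul, mul_right_comm, hsq, one_mul, sub_self]
  · intro B _ hB
    rw [map_smul, _root_.smul_apply, hξ.orthogonal B A hB, smul_zero]
  · simp

end TangentField

end LorentzianMetric

namespace LorentzianMetric

/-! ### The second fundamental form on tangent Killing fields -/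

section Killing

variable {m n : ℕ} {M : Type*} [TopologicalSpace M]
    [ChartedSpace (EuclideanSpace ℝ (Fin m)) M] [IsManifold (𝓡 m) ∞ M]
    {S : Type*} [TopologicalSpace S]
    [ChartedSpace (EuclideanSpace ℝ (Fin n)) S] [IsManifold (𝓡 n) ∞ S]
    {g : LorentzianMetric m M} {K : Π x : M, TangentSpace (𝓡 m) x}

lemma mdifferentiableAt_inner (g : LorentzianMetric m M) {X Y : Π x : M, TangentSpace (𝓡 m) x}
    {x : M}
    (hX : MDifferentiableAt (𝓡 m) (𝓡 m).tangent
      (fun y ↦ (⟨y, X y⟩ : TangentBundle (𝓡 m) M)) x)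
    (hY : MDifferentiableAt (𝓡 m) (𝓡 m).tangent
      (fun y ↦ (⟨y, Y y⟩ : TangentBundle (𝓡 m) M)) x) :
    MDifferentiableAt (𝓡 m) 𝓘(ℝ, ℝ) (fun y ↦ g.inner y (X y) (Y y)) x := by
  rw [mdifferentiableAt_section] at hX hY
  refine (((g.mdifferentiableAt_coeff x).clm_apply hX).clm_apply hY).congr_of_eventuallyEq ?_
  filter_upwards [(trivializationAt (EuclideanSpace ℝ (Fin m)) (TangentSpace (𝓡 m)) x
    ).open_baseSet.mem_nhds (FiberBundle.mem_baseSet_trivializationAt' x)] with y hy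
  exact (g.coeff_apply hy _ _).symm

lemma IsKilling.mdifferentiableAt (hK : g.IsKilling K) (x : M) :
    MDifferentiableAt (𝓡 m) (𝓡 m).tangent
      (fun y ↦ (⟨y, K y⟩ : TangentBundle (𝓡 m) M)) x :=
  (hK.contMDiff x).mdifferentiableAt (by simp)

/-- The second fundamental form on a Killing vector field that is tangent to `S`. -/
lemma IsKilling.secondFundamentalForm_eq (hK : g.IsKilling K) {gS : LorentzianMetric n S}
    {f : S → M} (hf : IsIsometricEmbedding g gS f)
    (hKt : ∀ q, K (f q) ∈ Set.range (mfderiv (𝓡 n) (𝓡 m) f q)) {p : S}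
    {ξ : Fin (m - n) → TangentSpace (𝓡 m) (f p)} (hξ : g.IsNormalFrame n f p ξ)
    {x : TangentSpace (𝓡 n) p} (hx : mfderiv (𝓡 n) (𝓡 m) f p x = K (f p))
    (y : TangentSpace (𝓡 n) p) :
    g.secondFundamentalForm gS f p x y = g.mixedBlock ξ K (mfderiv (𝓡 n) (𝓡 m) f p y) := by
  rw [hf.secondFundamentalForm_eq_normalPart (hK.mdifferentiableAt _) hKt hx,
    hf.normalPart_eq_sum hξ, mixedBlock, ← Finset.sum_neg_distrib]
  refine Finset.sum_congr rfl fun A _ ↦ ?_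
  -- Skew-symmetry of ∇K moves the derivative from the tangent direction `y` to the normal direction
  -- ξ_A, at the cost of a sign.
  have h := hK.killing_eq (f p) (mfderiv (𝓡 n) (𝓡 m) f p y) (ξ A)
  rw [g.symm _ _ (g.leviCivita K (f p) (ξ A)), add_eq_zero_iff_eq_neg] at h
  rw [h, mul_neg, neg_smul]

end Killing

/-! ### Algebra of the Gram matrix, ρ̂ and τ -/

section Gram

variable {m n : ℕ} {M : Type*} [TopologicalSpace M]
    [ChartedSpace (EuclideanSpace ℝ (Fin m)) M] [IsManifold (𝓡 m) ∞ M]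
    {g : LorentzianMetric m M} {K : Fin 2 → Π x : M, TangentSpace (𝓡 m) x}

lemma gram_symm (g : LorentzianMetric m M) (K : Fin 2 → Π x : M, TangentSpace (𝓡 m) x) (x : M)
    (α β : Fin 2) : g.gram K x α β = g.gram K x β α :=
  g.symm x _ _

lemma IsStationaryAxisymmetric.mdifferentiableAt_gram (hK : g.IsStationaryAxisymmetric K) (x : M)
    (α β : Fin 2) : MDifferentiableAt (𝓡 m) 𝓘(ℝ, ℝ) (fun y ↦ g.gram K y α β) x :=
  g.mdifferentiableAt_inner ((hK.isKilling α).mdifferentiableAt x)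
    ((hK.isKilling β).mdifferentiableAt x)

/-- The two terms of the product rule coincide: ⟨K_α, ∇_v K_β⟩ = -⟨v, ∇_{K_α} K_β⟩ = -⟨v, ∇_{K_β}
K_α⟩ = ⟨∇_v K_α, K_β⟩. The outer equalities are the Killing equations; the middle one is zero
torsion with vanishing bracket. -/
lemma IsStationaryAxisymmetric.mvfderiv_gram (hK : g.IsStationaryAxisymmetric K) (x : M)
    (α β : Fin 2) (v : TangentSpace (𝓡 m) x) :
    mvfderiv (𝓡 m) (fun y ↦ g.gram K y α β) x v =
      2 * g.inner x (g.leviCivita (K α) x v) (K β x) := by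
  have hα := (hK.isKilling α).mdifferentiableAt x
  have hβ := (hK.isKilling β).mdifferentiableAt x
  have h1 := (hK.isKilling α).killing_eq x v (K β x)
  have h2 := (hK.isKilling β).killing_eq x v (K α x)
  have h3 := g.leviCivita_torsion hα hβ
  rw [hK.commute, sub_eq_zero] at h3
  rw [h3] at h2
  refine (g.leviCivita_inner hα hβ v).trans ?_
  rw [g.symm x (K α x)]
  linarith

lemma IsStationaryAxisymmetric.mixedBlock_eq (hK : g.IsStationaryAxisymmetric K) {k : ℕ} {x : M}
    (ξ : Fin k → TangentSpace (𝓡 m) x) (α β : Fin 2) :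
    g.mixedBlock ξ (K α) (K β x) =
      -((1 / 2 : ℝ) • g.normalGrad ξ (fun y ↦ g.gram K y α β)) := by
  rw [mixedBlock, normalGrad, Finset.smul_sum]
  congr 1
  refine Finset.sum_congr rfl fun A _ ↦ ?_
  rw [hK.mvfderiv_gram, smul_smul]
  congr 1
  ring

lemma inner_rhoHat (g : LorentzianMetric m M) (K : Fin 2 → Π x : M, TangentSpace (𝓡 m) x) (ρ : ℝ)
    (x : M) : g.inner x (rhoHat K ρ x) (rhoHat K ρ x) =
      ρ ^ 2 * g.gram K x 0 0 + 2 * ρ * g.gram K x 0 1 + g.gram K x 1 1 := by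
  have h := g.gram_symm K x 1 0
  simp only [gram, Matrix.of_apply] at h ⊢
  simp only [rhoHat, rhoCoeff, Fin.sum_univ_two, map_add, add_apply, map_smul, _root_.smul_apply,
    smul_eq_mul, Matrix.cons_val_zero, Matrix.cons_val_one, h]
  ring

lemma det_gram (g : LorentzianMetric m M) (K : Fin 2 → Π x : M, TangentSpace (𝓡 m) x) (x : M) :
    (g.gram K x).det = g.gram K x 0 0 * g.gram K x 1 1 - g.gram K x 0 1 * g.gram K x 0 1 := by
  rw [Matrix.det_fin_two, g.gram_symm K x 1 0]

/-- The adjugate formula removes the matrix inverse. The last factor is ⟨ρ̂, K_φ⟩; in the other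
component it is ⟨ρ̂, K_t⟩ with the opposite sign, so τ ⊥ ρ̂ becomes a cancellation. -/
lemma tauCoeff_zero (g : LorentzianMetric m M) (K : Fin 2 → Π x : M, TangentSpace (𝓡 m) x) (ρ : ℝ)
    (x : M) : g.tauCoeff K ρ x 0 =
      √|(g.gram K x).det| * (g.gram K x).det⁻¹ * (g.gram K x 1 1 + ρ * g.gram K x 0 1) := by
  simp only [tauCoeff, epsilon, Matrix.inv_def, Matrix.adjugate_fin_two, Ring.inverse_eq_inv',
    rhoCoeff, Matrix.mulVec, dotProduct, Matrix.mul_apply, Fin.sum_univ_two]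
  simp
  ring

lemma tauCoeff_one (g : LorentzianMetric m M) (K : Fin 2 → Π x : M, TangentSpace (𝓡 m) x) (ρ : ℝ)
    (x : M) : g.tauCoeff K ρ x 1 =
      -(√|(g.gram K x).det| * (g.gram K x).det⁻¹ * (g.gram K x 0 1 + ρ * g.gram K x 0 0)) := by
  simp only [tauCoeff, epsilon, Matrix.inv_def, Matrix.adjugate_fin_two, Ring.inverse_eq_inv',
    rhoCoeff, Matrix.mulVec, dotProduct, Matrix.mul_apply, Fin.sum_univ_two, g.gram_symm K x 1 0]
  simp
  ring

/-- The vector `τ^α K_α` is orthogonal to `ρ̂`. -/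
lemma sum_tauCoeff_inner_rhoHat (g : LorentzianMetric m M)
    (K : Fin 2 → Π x : M, TangentSpace (𝓡 m) x) (ρ : ℝ) (x : M) :
    ∑ α, g.tauCoeff K ρ x α * g.inner x (rhoHat K ρ x) (K α x) = 0 := by
  have h (α : Fin 2) : g.inner x (rhoHat K ρ x) (K α x) = ρ * g.gram K x 0 α + g.gram K x 1 α := by
    simp [rhoHat, rhoCoeff, Fin.sum_univ_two, gram]
  rw [Fin.sum_univ_two, h, h, tauCoeff_zero, tauCoeff_one, g.gram_symm K x 1 0]
  ring

/-- The square root enters quadratic expressions in τ only through its square. The sign, from 𝒢 < 0,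
is that of a Lorentzian Killing plane. -/
lemma IsStationaryAxisymmetric.sqrt_det_mul_self (hK : g.IsStationaryAxisymmetric K) (x : M) :
    √|(g.gram K x).det| * √|(g.gram K x).det| = -(g.gram K x).det := by
  rw [Real.mul_self_sqrt (abs_nonneg _), abs_of_neg (hK.det_neg x)]

/-- Rotation by ε in a Lorentzian plane reverses the sign of the norm: ⟨τ, τ⟩ = -⟨ρ̂, ρ̂⟩. The
factor 𝒢⁻¹ is kept to match the function in the master equation. -/
lemma IsStationaryAxisymmetric.det_inv_mul_inner_rhoHat (hK : g.IsStationaryAxisymmetric K) (ρ : ℝ)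
    (x : M) : (g.gram K x).det⁻¹ * g.inner x (rhoHat K ρ x) (rhoHat K ρ x) =
      -(g.gram K x).det⁻¹ *
        ∑ α, ∑ β, g.tauCoeff K ρ x α * g.tauCoeff K ρ x β * g.gram K x α β := by
  have hs := hK.sqrt_det_mul_self x
  have hd := g.det_gram K x
  have h0 : (g.gram K x).det ≠ 0 := (hK.det_neg x).ne
  rw [inner_rhoHat]
  simp only [Fin.sum_univ_two, tauCoeff_zero, tauCoeff_one, g.gram_symm K x 1 0]
  generalize √|(g.gram K x).det| = s at *
  generalize (g.gram K x).det = D at *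
  generalize g.gram K x 0 0 = a at *
  generalize g.gram K x 0 1 = b at *
  generalize g.gram K x 1 1 = d at *
  -- Collects s² = -D and the factor ad - b² = D, which together cancel D⁻² up to a sign.
  have e : s * D⁻¹ * (d + ρ * b) * (s * D⁻¹ * (d + ρ * b)) * a +
      s * D⁻¹ * (d + ρ * b) * -(s * D⁻¹ * (b + ρ * a)) * b +
      (-(s * D⁻¹ * (b + ρ * a)) * (s * D⁻¹ * (d + ρ * b)) * b +
      -(s * D⁻¹ * (b + ρ * a)) * -(s * D⁻¹ * (b + ρ * a)) * d) =
      (s * s) * D⁻¹ * D⁻¹ * (a * d - b * b) * (ρ ^ 2 * a + 2 * ρ * b + d) := by ring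
  rw [e, hs, ← hd]
  field_simp

/-! ### Differentiating 𝒢 and 𝒢⁻¹⟨ρ̂, ρ̂⟩ -/

lemma IsStationaryAxisymmetric.mdifferentiableAt_det (hK : g.IsStationaryAxisymmetric K) (x : M) :
    MDifferentiableAt (𝓡 m) 𝓘(ℝ, ℝ) (fun y ↦ (g.gram K y).det) x := by
  simp only [det_gram]
  exact ((hK.mdifferentiableAt_gram x 0 0).mul (hK.mdifferentiableAt_gram x 1 1)).sub
    ((hK.mdifferentiableAt_gram x 0 1).mul (hK.mdifferentiableAt_gram x 0 1))

lemma mvfderiv_comp_of_hasDerivAt {φ : M → ℝ} {x : M} (hφ : MDifferentiableAt (𝓡 m) 𝓘(ℝ, ℝ) φ x)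
    {h : ℝ → ℝ} {h' : ℝ} (hh : HasDerivAt h h' (φ x)) (v : TangentSpace (𝓡 m) x) :
    mvfderiv (𝓡 m) (fun y ↦ h (φ y)) x v = h' * mvfderiv (𝓡 m) φ x v := by
  have h1 := (hasMFDerivAt_iff_hasFDerivAt.2 hh.hasFDerivAt).comp x hφ.hasMFDerivAt
  refine (congr($(h1.mfderiv) v)).trans ?_
  exact mul_comm (mvfderiv (𝓡 m) φ x v) h'

lemma IsStationaryAxisymmetric.mdifferentiableAt_det_inv (hK : g.IsStationaryAxisymmetric K)
    (x : M) : MDifferentiableAt (𝓡 m) 𝓘(ℝ, ℝ) (fun y ↦ (g.gram K y).det⁻¹) x :=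
  DifferentiableAt.comp_mdifferentiableAt (f := fun y ↦ (g.gram K y).det)
    (hasDerivAt_inv (hK.det_neg x).ne).differentiableAt (hK.mdifferentiableAt_det x)

lemma IsStationaryAxisymmetric.mdifferentiableAt_inner_rhoHat (hK : g.IsStationaryAxisymmetric K)
    (ρ : ℝ) (x : M) :
    MDifferentiableAt (𝓡 m) 𝓘(ℝ, ℝ) (fun y ↦ g.inner y (rhoHat K ρ y) (rhoHat K ρ y)) x := by
  simp only [inner_rhoHat]
  exact ((mdifferentiableAt_const.mul (hK.mdifferentiableAt_gram x 0 0)).add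
    (mdifferentiableAt_const.mul (hK.mdifferentiableAt_gram x 0 1))).add
    (hK.mdifferentiableAt_gram x 1 1)

lemma IsStationaryAxisymmetric.mvfderiv_det (hK : g.IsStationaryAxisymmetric K) (x : M)
    (v : TangentSpace (𝓡 m) x) :
    mvfderiv (𝓡 m) (fun y ↦ (g.gram K y).det) x v =
      g.gram K x 0 0 * mvfderiv (𝓡 m) (fun y ↦ g.gram K y 1 1) x v +
      g.gram K x 1 1 * mvfderiv (𝓡 m) (fun y ↦ g.gram K y 0 0) x v -
      2 * g.gram K x 0 1 * mvfderiv (𝓡 m) (fun y ↦ g.gram K y 0 1) x v := by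
  have h00 := hK.mdifferentiableAt_gram x 0 0
  have h01 := hK.mdifferentiableAt_gram x 0 1
  have h11 := hK.mdifferentiableAt_gram x 1 1
  have h1 : MDifferentiableAt (𝓡 m) 𝓘(ℝ, ℝ) (fun y ↦ g.gram K y 0 0 * g.gram K y 1 1) x :=
    h00.mul h11
  have h2 : MDifferentiableAt (𝓡 m) 𝓘(ℝ, ℝ) (fun y ↦ g.gram K y 0 1 * g.gram K y 0 1) x :=
    h01.mul h01
  simp only [det_gram]
  rw [mvfderiv_fun_sub h1 h2, mvfderiv_fun_mul h00 h11,
    mvfderiv_fun_mul h01 h01]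
  simp only [sub_apply, add_apply, _root_.smul_apply, smul_eq_mul]
  ring

lemma IsStationaryAxisymmetric.mvfderiv_inner_rhoHat (hK : g.IsStationaryAxisymmetric K)
    (ρ : ℝ) (x : M) (v : TangentSpace (𝓡 m) x) :
    mvfderiv (𝓡 m) (fun y ↦ g.inner y (rhoHat K ρ y) (rhoHat K ρ y)) x v =
      ρ ^ 2 * mvfderiv (𝓡 m) (fun y ↦ g.gram K y 0 0) x v +
      2 * ρ * mvfderiv (𝓡 m) (fun y ↦ g.gram K y 0 1) x v +
      mvfderiv (𝓡 m) (fun y ↦ g.gram K y 1 1) x v := by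
  have h00 := hK.mdifferentiableAt_gram x 0 0
  have h01 := hK.mdifferentiableAt_gram x 0 1
  have h11 := hK.mdifferentiableAt_gram x 1 1
  have hc (c : ℝ) : MDifferentiableAt (𝓡 m) 𝓘(ℝ, ℝ) (fun _ : M ↦ c) x := mdifferentiableAt_const
  have h1 : MDifferentiableAt (𝓡 m) 𝓘(ℝ, ℝ) (fun y ↦ ρ ^ 2 * g.gram K y 0 0) x := (hc _).mul h00
  have h2 : MDifferentiableAt (𝓡 m) 𝓘(ℝ, ℝ) (fun y ↦ 2 * ρ * g.gram K y 0 1) x := (hc _).mul h01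
  have h3 : MDifferentiableAt (𝓡 m) 𝓘(ℝ, ℝ)
    (fun y ↦ ρ ^ 2 * g.gram K y 0 0 + 2 * ρ * g.gram K y 0 1) x := h1.add h2
  simp only [inner_rhoHat]
  rw [mvfderiv_fun_add h3 h11, mvfderiv_fun_add h1 h2, mvfderiv_fun_mul (hc _) h00,
    mvfderiv_fun_mul (hc _) h01, mvfderiv_const, mvfderiv_const]
  simp only [add_apply, _root_.smul_apply, smul_eq_mul, zero_apply, mul_zero, add_zero]

/-- The derivative of `𝒢⁻¹ ⟨ρ̂, ρ̂⟩` in terms of the derivatives of `𝒢_αβ`. -/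
lemma IsStationaryAxisymmetric.mvfderiv_det_inv_mul_inner_rhoHat
    (hK : g.IsStationaryAxisymmetric K) (ρ : ℝ) (x : M) (v : TangentSpace (𝓡 m) x) :
    mvfderiv (𝓡 m) (fun y ↦ (g.gram K y).det⁻¹ * g.inner y (rhoHat K ρ y) (rhoHat K ρ y)) x v =
      (g.gram K x).det⁻¹ * ∑ α, ∑ β, g.tauCoeff K ρ x α * g.tauCoeff K ρ x β *
        mvfderiv (𝓡 m) (fun y ↦ g.gram K y α β) x v := by
  have hs := hK.sqrt_det_mul_self x
  have hd := g.det_gram K x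
  have h0 : (g.gram K x).det ≠ 0 := (hK.det_neg x).ne
  have h10 : (fun y ↦ g.gram K y 1 0) = fun y ↦ g.gram K y 0 1 :=
    funext fun y ↦ g.gram_symm K y 1 0
  rw [mvfderiv_fun_mul (hK.mdifferentiableAt_det_inv x) (hK.mdifferentiableAt_inner_rhoHat ρ x)]
  rw [add_apply, _root_.smul_apply, _root_.smul_apply, hK.mvfderiv_inner_rhoHat,
    mvfderiv_comp_of_hasDerivAt (hK.mdifferentiableAt_det x) (hasDerivAt_inv h0), hK.mvfderiv_det,
    inner_rhoHat]
  simp only [Fin.sum_univ_two, tauCoeff_zero, tauCoeff_one, h10, smul_eq_mul]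
  generalize mvfderiv (𝓡 m) (fun y ↦ g.gram K y 0 0) x v = a'
  generalize mvfderiv (𝓡 m) (fun y ↦ g.gram K y 0 1) x v = b'
  generalize mvfderiv (𝓡 m) (fun y ↦ g.gram K y 1 1) x v = d'
  generalize √|(g.gram K x).det| = s at *
  generalize (g.gram K x).det = D at *
  generalize g.gram K x 0 0 = a at *
  generalize g.gram K x 0 1 = b at *
  generalize g.gram K x 1 1 = d at *
  -- With values and derivatives of 𝒢_αβ as independent variables, the claim is a rational identity
  -- modulo s² = -D and D = ad - b². Only s² occurs, so it is exposed first; D is expanded after the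
  -- denominators are cleared.
  have e : s * D⁻¹ * (d + ρ * b) * (s * D⁻¹ * (d + ρ * b)) * a' +
      s * D⁻¹ * (d + ρ * b) * -(s * D⁻¹ * (b + ρ * a)) * b' +
      (-(s * D⁻¹ * (b + ρ * a)) * (s * D⁻¹ * (d + ρ * b)) * b' +
      -(s * D⁻¹ * (b + ρ * a)) * -(s * D⁻¹ * (b + ρ * a)) * d') =
      (s * s) * D⁻¹ * D⁻¹ * ((d + ρ * b) ^ 2 * a' - 2 * (d + ρ * b) * (b + ρ * a) * b' +
        (b + ρ * a) ^ 2 * d') := by ring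
  rw [e, hs]
  field_simp
  rw [hd]
  ring

end Gram

end LorentzianMetric

namespace LorentzianMetric

/-! ### The master equation -/

section MasterEquation

variable {m n : ℕ} {M : Type*} [TopologicalSpace M]
    [ChartedSpace (EuclideanSpace ℝ (Fin m)) M] [IsManifold (𝓡 m) ∞ M]
    {S : Type*} [TopologicalSpace S]
    [ChartedSpace (EuclideanSpace ℝ (Fin n)) S] [IsManifold (𝓡 n) ∞ S]
    {g : LorentzianMetric m M} {K : Fin 2 → Π x : M, TangentSpace (𝓡 m) x}

/-- The normal gradient at `x` depends only on the differential there. The coefficients may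
therefore be values at `x` of varying functions, such as τ^α τ^β, and not just constants. -/
lemma normalGrad_eq_sum (g : LorentzianMetric m M) {k : ℕ} {x : M}
    (ξ : Fin k → TangentSpace (𝓡 m) x) {φ : M → ℝ} (ψ : Fin 2 → Fin 2 → M → ℝ)
    (c : Fin 2 → Fin 2 → ℝ)
    (h : ∀ v, mvfderiv (𝓡 m) φ x v = ∑ α, ∑ β, c α β * mvfderiv (𝓡 m) (ψ α β) x v) :
    g.normalGrad ξ φ = ∑ α, ∑ β, c α β • g.normalGrad ξ (ψ α β) := by
  simp only [normalGrad, h, Fin.sum_univ_two, Finset.smul_sum, smul_smul,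
    ← Finset.sum_add_distrib, ← add_smul]
  refine Finset.sum_congr rfl fun A _ ↦ ?_
  congr 1
  ring

lemma inner_rhoHat_eq_sum (g : LorentzianMetric m M) (K : Fin 2 → Π x : M, TangentSpace (𝓡 m) x)
    (ρ : ℝ) (x : M) : g.inner x (rhoHat K ρ x) (rhoHat K ρ x) =
      ∑ α, ∑ β, rhoCoeff ρ α * rhoCoeff ρ β * g.gram K x α β := by
  rw [inner_rhoHat]
  simp only [rhoCoeff, Fin.sum_univ_two, Matrix.cons_val_zero, Matrix.cons_val_one,
    g.gram_symm K x 1 0]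
  ring

/-- The master equation as an equation for the function `𝒢⁻¹ ⟨ρ̂, ρ̂⟩`. -/
lemma IsStationaryAxisymmetric.masterForm_eq (hK : g.IsStationaryAxisymmetric K) (ρ : ℝ) {k : ℕ}
    {x : M} (ξ : Fin k → TangentSpace (𝓡 m) x) (h : TangentSpace (𝓡 m) x) :
    g.masterForm K ρ ξ h =
      (1 / 2 : ℝ) • g.normalGrad ξ
        (fun y ↦ (g.gram K y).det⁻¹ * g.inner y (rhoHat K ρ y) (rhoHat K ρ y)) -
      ((g.gram K x).det⁻¹ * g.inner x (rhoHat K ρ x) (rhoHat K ρ x)) • h := by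
  -- The components ρ^α are constant, so contraction with them commutes with differentiation.
  have hd : ∀ v, mvfderiv (𝓡 m)
      (fun y ↦ (g.gram K y).det⁻¹ * g.inner y (rhoHat K ρ y) (rhoHat K ρ y)) x v =
      ∑ α, ∑ β, rhoCoeff ρ α * rhoCoeff ρ β *
        mvfderiv (𝓡 m) (fun y ↦ (g.gram K y).det⁻¹ * g.gram K y α β) x v := by
    intro v
    have hu (α β : Fin 2) : mvfderiv (𝓡 m) (fun y ↦ (g.gram K y).det⁻¹ * g.gram K y α β) x v =
        (g.gram K x).det⁻¹ * mvfderiv (𝓡 m) (fun y ↦ g.gram K y α β) x v +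
          g.gram K x α β * mvfderiv (𝓡 m) (fun y ↦ (g.gram K y).det⁻¹) x v := by
      rw [mvfderiv_fun_mul (hK.mdifferentiableAt_det_inv x) (hK.mdifferentiableAt_gram x α β)]
      rfl
    have h10 : (fun y ↦ g.gram K y 1 0) = fun y ↦ g.gram K y 0 1 :=
      funext fun y ↦ g.gram_symm K y 1 0
    rw [mvfderiv_fun_mul (hK.mdifferentiableAt_det_inv x) (hK.mdifferentiableAt_inner_rhoHat ρ x),
      add_apply, _root_.smul_apply, _root_.smul_apply, hK.mvfderiv_inner_rhoHat, inner_rhoHat]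
    simp only [hu, Fin.sum_univ_two, rhoCoeff, Matrix.cons_val_zero, Matrix.cons_val_one,
      smul_eq_mul, h10, g.gram_symm K x 1 0]
    ring
  rw [g.normalGrad_eq_sum ξ _ _ hd, inner_rhoHat_eq_sum]
  simp only [masterForm, masterMatrix, Matrix.of_apply, Fin.sum_univ_two]
  module

lemma secondFundamentalForm_sum_smul_right (g : LorentzianMetric m M) (gS : LorentzianMetric n S)
    (f : S → M) {p : S} (x : TangentSpace (𝓡 n) p) (c : Fin 2 → ℝ)
    (k : Fin 2 → TangentSpace (𝓡 n) p) :
    g.secondFundamentalForm gS f p x (∑ α, c α • k α) =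
      ∑ α, c α • g.secondFundamentalForm gS f p x (k α) := by
  simp only [Fin.sum_univ_two, secondFundamentalForm_add_right, secondFundamentalForm_smul_right]

/-- The left argument enters through an extension to a vector field, so linearity is obtained from
the right slot by symmetry. -/
lemma secondFundamentalForm_sum_smul_left (g : LorentzianMetric m M) (gS : LorentzianMetric n S)
    {f : S → M} (hf : ContMDiff (𝓡 n) (𝓡 m) ∞ f) {p : S} (x : TangentSpace (𝓡 n) p)
    (c : Fin 2 → ℝ) (k : Fin 2 → TangentSpace (𝓡 n) p) :
    g.secondFundamentalForm gS f p (∑ α, c α • k α) x =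
      ∑ α, c α • g.secondFundamentalForm gS f p (k α) x := by
  rw [g.secondFundamentalForm_symm gS hf, secondFundamentalForm_sum_smul_right]
  exact Finset.sum_congr rfl fun α _ ↦ by rw [g.secondFundamentalForm_symm gS hf]

lemma tau_mem_rhoPerp (g : LorentzianMetric m M) (K : Fin 2 → Π x : M, TangentSpace (𝓡 m) x)
    (ρ : ℝ) {f : S → M} {p : S} {k : Fin 2 → TangentSpace (𝓡 n) p}
    (hk : ∀ α, mfderiv (𝓡 n) (𝓡 m) f p (k α) = K α (f p)) :
    ∑ α, g.tauCoeff K ρ (f p) α • k α ∈ g.rhoPerp K ρ n f p := by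
  change g.inner (f p) (rhoHat K ρ (f p)) (mfderiv (𝓡 n) (𝓡 m) f p _) = 0
  rw [map_sum, map_sum, ← g.sum_tauCoeff_inner_rhoHat K ρ (f p)]
  refine Finset.sum_congr rfl fun α _ ↦ ?_
  rw [map_smul, map_smul, hk, smul_eq_mul]

lemma mem_rhoPerp (g : LorentzianMetric m M) (K : Fin 2 → Π x : M, TangentSpace (𝓡 m) x)
    (ρ : ℝ) {f : S → M} {p : S} {x : TangentSpace (𝓡 n) p}
    (hx : ∀ α, g.inner (f p) (K α (f p)) (mfderiv (𝓡 n) (𝓡 m) f p x) = 0) :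
    x ∈ g.rhoPerp K ρ n f p := by
  change g.inner (f p) (rhoHat K ρ (f p)) (mfderiv (𝓡 n) (𝓡 m) f p x) = 0
  simp [rhoHat, Fin.sum_univ_two, hx]

variable {gS : LorentzianMetric n S} {f : S → M} {p : S}

lemma IsStationaryAxisymmetric.secondFundamentalForm_killing (hK : g.IsStationaryAxisymmetric K)
    (hf : g.IsIsometricEmbedding gS f) (hinv : IsInvariant n f K)
    {ξ : Fin (m - n) → TangentSpace (𝓡 m) (f p)} (hξ : g.IsNormalFrame n f p ξ)
    {k : Fin 2 → TangentSpace (𝓡 n) p}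
    (hk : ∀ α, mfderiv (𝓡 n) (𝓡 m) f p (k α) = K α (f p)) (α β : Fin 2) :
    g.secondFundamentalForm gS f p (k α) (k β) =
      -((1 / 2 : ℝ) • g.normalGrad ξ (fun x ↦ g.gram K x α β)) := by
  rw [(hK.isKilling α).secondFundamentalForm_eq hf (hinv.tangent α) hξ (hk α), hk, hK.mixedBlock_eq]

/-- The master equation for the umbilic factor. -/
lemma IsStationaryAxisymmetric.masterForm_eq_zero (hK : g.IsStationaryAxisymmetric K)
    (hf : g.IsIsometricEmbedding gS f) (hinv : IsInvariant n f K) {ρ : ℝ}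
    {H : Π p : S, TangentSpace (𝓡 m) (f p)} (hH : g.IsTotallyUmbilicOn gS f (g.rhoPerp K ρ n f) H)
    {ξ : Fin (m - n) → TangentSpace (𝓡 m) (f p)} (hξ : g.IsNormalFrame n f p ξ) :
    g.masterForm K ρ ξ (H p) = 0 := by
  -- Preimages in T_pS of the Killing vectors; they suffice to form τ, and no adapted basis has to
  -- exist.
  choose k hk using fun α ↦ hinv.tangent α p
  have hτ := g.tau_mem_rhoPerp K ρ hk
  have h := hH.secondFundamentalForm_eq p _ _ hτ hτ
  have hin : gS.inner p (∑ α, g.tauCoeff K ρ (f p) α • k α) (∑ α, g.tauCoeff K ρ (f p) α • k α) =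
      ∑ α, ∑ β, g.tauCoeff K ρ (f p) α * g.tauCoeff K ρ (f p) β * g.gram K (f p) α β := by
    rw [hf.inner_eq, Fin.sum_univ_two, map_add, map_smul, map_smul, hk, hk]
    simp only [map_add, add_apply, map_smul, _root_.smul_apply, smul_eq_mul, Fin.sum_univ_two, gram,
      Matrix.of_apply]
    ring
  simp only [g.secondFundamentalForm_sum_smul_left gS hf.isSmoothEmbedding.contMDiff,
    secondFundamentalForm_sum_smul_right, hin, hK.secondFundamentalForm_killing hf hinv hξ hk] at h
  -- Both terms of ½∇^⊥φ - φH are rewritten through τ. Then `h`, which now reads -½ τ^α τ^β ∇^⊥𝒢_αβ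
  -- = ⟨τ, τ⟩ H, eliminates `H` and everything cancels.
  rw [hK.masterForm_eq, hK.det_inv_mul_inner_rhoHat, g.normalGrad_eq_sum ξ
    (fun α β y ↦ g.gram K y α β)
    (fun α β ↦ (g.gram K (f p)).det⁻¹ * (g.tauCoeff K ρ (f p) α * g.tauCoeff K ρ (f p) β))
    (fun v ↦ by
      rw [hK.mvfderiv_det_inv_mul_inner_rhoHat, Finset.mul_sum]
      refine Finset.sum_congr rfl fun α _ ↦ ?_
      rw [Finset.mul_sum]
      exact Finset.sum_congr rfl fun β _ ↦ (mul_assoc _ _ _).symm)]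
  rw [neg_mul, neg_smul, sub_neg_eq_add, mul_smul, ← h]
  simp only [Fin.sum_univ_two]
  module

/-- The master equation solved for the umbilic factor. -/
lemma IsStationaryAxisymmetric.masterForm_eq_zero_iff (hK : g.IsStationaryAxisymmetric K) {ρ : ℝ}
    {k : ℕ} {x : M} (ξ : Fin k → TangentSpace (𝓡 m) x)
    (hρ : g.inner x (rhoHat K ρ x) (rhoHat K ρ x) ≠ 0) (h : TangentSpace (𝓡 m) x) :
    g.masterForm K ρ ξ h = 0 ↔ h = (1 / 2 : ℝ) • g.normalGrad ξ (fun y ↦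
      Real.log |(g.gram K y).det⁻¹ * g.inner y (rhoHat K ρ y) (rhoHat K ρ y)|) := by
  have h0 : (g.gram K x).det⁻¹ * g.inner x (rhoHat K ρ x) (rhoHat K ρ x) ≠ 0 :=
    mul_ne_zero (inv_ne_zero (hK.det_neg x).ne) hρ
  have hlog : g.normalGrad ξ (fun y ↦
      Real.log |(g.gram K y).det⁻¹ * g.inner y (rhoHat K ρ y) (rhoHat K ρ y)|) =
      ((g.gram K x).det⁻¹ * g.inner x (rhoHat K ρ x) (rhoHat K ρ x))⁻¹ • g.normalGrad ξ
        (fun y ↦ (g.gram K y).det⁻¹ * g.inner y (rhoHat K ρ y) (rhoHat K ρ y)) := by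
    have hφ : MDifferentiableAt (𝓡 m) 𝓘(ℝ, ℝ)
        (fun y ↦ (g.gram K y).det⁻¹ * g.inner y (rhoHat K ρ y) (rhoHat K ρ y)) x :=
      (hK.mdifferentiableAt_det_inv x).mul (hK.mdifferentiableAt_inner_rhoHat ρ x)
    -- `Real.log` is even, so the absolute value drops and the derivative is φ'/φ for either sign of
    -- φ.
    simp only [normalGrad, Real.log_abs, mvfderiv_comp_of_hasDerivAt hφ (Real.hasDerivAt_log h0),
      Finset.smul_sum, smul_smul]
    refine Finset.sum_congr rfl fun A _ ↦ ?_
    congr 1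
    ring
  rw [hK.masterForm_eq, sub_eq_zero, hlog, smul_comm, eq_inv_smul_iff₀ h0, eq_comm]

end MasterEquation

end LorentzianMetric

/-! ### Assembly of the three claims -/

theorem proposition4 {m n : ℕ}
    {M : Type*} [TopologicalSpace M] [ChartedSpace (EuclideanSpace ℝ (Fin m)) M]
    [IsManifold (𝓡 m) ∞ M]
    {S : Type*} [TopologicalSpace S] [ChartedSpace (EuclideanSpace ℝ (Fin n)) S]
    [IsManifold (𝓡 n) ∞ S]
    (g : LorentzianMetric m M) (K : Fin 2 → Π x : M, TangentSpace (𝓡 m) x)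
    (hK : g.IsStationaryAxisymmetric K)
    (gS : LorentzianMetric n S) (f : S → M) (hf : g.IsIsometricEmbedding gS f)
    (hinv : LorentzianMetric.IsInvariant n f K)
    (ρ : ℝ) (H : Π p : S, TangentSpace (𝓡 m) (f p))
    (hH : g.IsTotallyUmbilicOn gS f (g.rhoPerp K ρ n f) H)
    (p : S) (ξ : Fin (m - n) → TangentSpace (𝓡 m) (f p)) (hξ : g.IsNormalFrame n f p ξ) :
    -- the block form and the mixed condition in any basis `{K_α, e_a}`
    (∀ b : Module.Basis (Fin 2 ⊕ Fin (n - 2)) ℝ (TangentSpace (𝓡 n) p), g.IsAdaptedBasis K f p b →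
      (Matrix.of fun i j ↦ g.secondFundamentalForm gS f p (b i) (b j)) =
        Matrix.fromBlocks
          (Matrix.of fun α β ↦ -((1 / 2 : ℝ) • g.normalGrad ξ (fun x ↦ g.gram K x α β)))
          (Matrix.of fun α c ↦
            g.mixedBlock ξ (K α) (mfderiv (𝓡 n) (𝓡 m) f p (b (.inr c))))
          (Matrix.of fun a β ↦
            g.mixedBlock ξ (K β) (mfderiv (𝓡 n) (𝓡 m) f p (b (.inr a))))
          (Matrix.of fun a c ↦ gS.inner p (b (.inr a)) (b (.inr c)) • H p) ∧
      ∀ a, ∑ α, g.tauCoeff K ρ (f p) α •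
        g.secondFundamentalForm gS f p (b (.inl α)) (b (.inr a)) = 0) ∧
    -- the master equation
    g.masterForm K ρ ξ (H p) = 0 ∧
    -- the master equation solved for the umbilic factor, where `ρ̂` is not null
    (g.inner (f p) (LorentzianMetric.rhoHat K ρ (f p)) (LorentzianMetric.rhoHat K ρ (f p)) ≠ 0 →
      (∀ h : TangentSpace (𝓡 m) (f p), g.masterForm K ρ ξ h = 0 ↔
        h = (1 / 2 : ℝ) • g.normalGrad ξ (fun x ↦ Real.log |(g.gram K x).det⁻¹ *
          g.inner x (LorentzianMetric.rhoHat K ρ x) (LorentzianMetric.rhoHat K ρ x)|)) ∧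
      H p = (1 / 2 : ℝ) • g.normalGrad ξ (fun x ↦ Real.log |(g.gram K x).det⁻¹ *
          g.inner x (LorentzianMetric.rhoHat K ρ x) (LorentzianMetric.rhoHat K ρ x)|)) := by
  refine ⟨fun b hb ↦ ⟨?_, fun a ↦ ?_⟩, hK.masterForm_eq_zero hf hinv hH hξ, fun hρ ↦
    ⟨hK.masterForm_eq_zero_iff ξ hρ,
      (hK.masterForm_eq_zero_iff ξ hρ _).1 (hK.masterForm_eq_zero hf hinv hH hξ)⟩⟩
  · ext1 i j
    have hKe (α : Fin 2) (y : TangentSpace (𝓡 n) p) :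
        g.secondFundamentalForm gS f p (b (.inl α)) y =
          g.mixedBlock ξ (K α) (mfderiv (𝓡 n) (𝓡 m) f p y) :=
      (hK.isKilling α).secondFundamentalForm_eq hf (hinv.tangent α) hξ (hb.killing α) y
    rcases i with α | a <;> rcases j with β | c
    · exact hK.secondFundamentalForm_killing hf hinv hξ hb.killing α β
    · exact hKe α _
    -- The Killing formula has the Killing vector in the first slot, so this block is reached by
    -- symmetry.
    · exact (g.secondFundamentalForm_symm gS hf.isSmoothEmbedding.contMDiff _ _).trans (hKe β _)
    · exact hH.secondFundamentalForm_eq p _ _ (g.mem_rhoPerp K ρ fun α ↦ hb.orthogonal α a)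
        (g.mem_rhoPerp K ρ fun α ↦ hb.orthogonal α c)
  -- Both τ and e_a are orthogonal to ρ̂, so II(τ, e_a) = ⟨τ, e_a⟩ H, and ⟨τ, e_a⟩ = 0 because τ
  -- lies in the Killing plane.
  · rw [← g.secondFundamentalForm_sum_smul_left gS hf.isSmoothEmbedding.contMDiff,
      hH.secondFundamentalForm_eq p _ _ (g.tau_mem_rhoPerp K ρ hb.killing)
        (g.mem_rhoPerp K ρ fun α ↦ hb.orthogonal α a), hf.inner_eq]
    rw [Fin.sum_univ_two, map_add, map_smul, map_smul, hb.killing, hb.killing, map_add, add_apply,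
      map_smul, map_smul, _root_.smul_apply, _root_.smul_apply, hb.orthogonal, hb.orthogonal]
    simp
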